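/- Let $0<\alpha\le 1$. For a bounded open set $\Omega\subset\mathbb{R}^2$ consider the fractional Laplacian $(-\Delta)^{\alpha/2}$ on $\Omega$ with Dirichlet condition outside $\Omega$, that is, the operator given by the quadratic form $$Q(u,v)=\int_{\mathbb{R}^2}|2\pi\xi|^{\alpha}\,\widehat u(\xi)\,\overline{\widehat v(\xi)}\,d\xi,\qquad \widehat u(\xi)=\int_{\mathbb{R}^2}u(x)e^{-2\pi i\xi\cdot x}\,dx,$$ with domain $H_0^{\alpha/2}(\Omega)$, the closure of $C_c^\infty(\Omega)$ in the norm $\left(\|u\|_{L^2}^2+Q(u,u)\right)^{1/2}$. A number $\lambda$ is an eigenvalue if there is $0\ne u\in H_0^{\alpha/2}(\Omega)$ with $Q(u,v)=\lambda\langle u,v\rangle_{L^2}$ for all $v\in H_0^{\alpha/2}(\Omega)$. Let $E$ be an ellipse (the open planar region bounded by an ellipse, with any centre, axes and semiaxes $a,b>0$), with perimeter $L$ and area $A$. Then its eigenvalues can be listed, with multiplicity, as $\lambda_1\le\lambda_2\le\lambda_3\le\dots$ (for every $k$ there is a smallest $\lambda_k=\lambda_k(E)$ such that at least $k$ eigenvalues,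 counted with multiplicity, are $\le\lambda_k$), and for every $n\ge 1$ the quantity $$\left(\lambda_1+\dots+\lambda_n\right)^{2/\alpha}A\cdot\frac{A}{L^2}$$ evaluated on $E$ is at most its value on any disk. In other words, among all ellipses it is maximal when $E$ is a disk. -/

import Mathlib

open MeasureTheory
open scoped ENNReal ContDiff FourierTransform

noncomputable section

/-- The Euclidean plane. -/
abbrev Plane : Type := EuclideanSpace ℝ (Fin 2)

/-- The complex Hilbert space `L²(ℝ²)`. -/
abbrev L2Plane : Type := Lp (α := Plane) ℂ 2

/-- `E` is an ellipse, that is, the open planar region bounded by an ellipse: for some centre `c`,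
orthonormal axes `e` and semiaxes `a, b > 0` it is given by `x² / a² + y² / b² < 1` in the
coordinates `x, y` with respect to `c` and `e`. -/
def IsEllipse (E : Set Plane) : Prop :=
  ∃ (c : Plane) (e : OrthonormalBasis (Fin 2) ℝ Plane) (a b : ℝ), 0 < a ∧ 0 < b ∧
    E = {x | (inner ℝ (e 0) (x - c)) ^ 2 / a ^ 2 + (inner ℝ (e 1) (x - c)) ^ 2 / b ^ 2 < 1}

/-- `D` is an open disk. -/
def IsDisk (D : Set Plane) : Prop :=
  ∃ (c : Plane) (r : ℝ), 0 < r ∧ D = Metric.ball c r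

/-- The area of a planar set. -/
def area (E : Set Plane) : ℝ := (volume E).toReal

/-- The perimeter: the length (one-dimensional Hausdorff measure) of the boundary. -/
def perimeter (E : Set Plane) : ℝ := (Measure.hausdorffMeasure 1 (frontier E)).toReal

/-- The symbol `|2πξ|^α` of `(-Δ)^{α/2}`, for the Fourier transform
`û(ξ) = ∫ u(x) exp(-2πi ξ·x) dx`. -/
def fracSymbol (α : ℝ) (ξ : Plane) : ℝ := (2 * Real.pi * ‖ξ‖) ^ α

/-- The energy `∫ |2πξ|^α |û(ξ)|² dξ ∈ [0, ∞]`: the squared Sobolev seminorm of order `α/2`. -/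
def fracEnergy (α : ℝ) (u : L2Plane) : ℝ≥0∞ :=
  ∫⁻ ξ : Plane, ENNReal.ofReal (fracSymbol α ξ * ‖(𝓕 u : L2Plane) ξ‖ ^ 2)

/-- Membership in `H₀^{α/2}(Ω)`, the closure of `C_c^∞(Ω)` in the Sobolev norm
`(‖u‖² + ∫ |2πξ|^α |û|² dξ)^{1/2}`. -/
def MemH0 (α : ℝ) (Ω : Set Plane) (u : L2Plane) : Prop :=
  ∀ ε : ℝ≥0∞, 0 < ε → ∃ (φ : Plane → ℂ) (hφ : MemLp φ 2 (volume : Measure Plane)),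
    ContDiff ℝ ∞ φ ∧ HasCompactSupport φ ∧ tsupport φ ⊆ Ω ∧
      ENNReal.ofReal (‖u - hφ.toLp φ‖ ^ 2) + fracEnergy α (u - hφ.toLp φ) < ε

/-- The quadratic form of `(-Δ)^{α/2}`: `Q(u, v) = ∫ |2πξ|^α û(ξ) conj(v̂(ξ)) dξ`. -/
def fracForm (α : ℝ) (u v : L2Plane) : ℂ :=
  ∫ ξ : Plane, (fracSymbol α ξ : ℂ) *
    ((𝓕 u : L2Plane) ξ * (starRingEnd ℂ) ((𝓕 v : L2Plane) ξ))

/-- `u` is a (possibly zero) weak solution of `(-Δ)^{α/2} u = t u` in `Ω`, `u = 0` outside `Ω`. -/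
def IsWeakEigenfunction (α : ℝ) (Ω : Set Plane) (t : ℝ) (u : L2Plane) : Prop :=
  MemH0 α Ω u ∧ ∀ v : L2Plane, MemH0 α Ω v → fracForm α u v = (t : ℂ) * inner ℂ v u

/-- The numbers `t` for which at least `k` eigenvalues, counted with multiplicity, are `≤ t`: the
eigenfunctions with eigenvalue `≤ t` span a space of dimension at least `k`. -/
def eigenvalueLevels (α : ℝ) (Ω : Set Plane) (k : ℕ) : Set ℝ :=
  {t | (k : Cardinal) ≤
    Module.rank ℂ (Submodule.span ℂ {u : L2Plane | ∃ s ≤ t, IsWeakEigenfunction α Ω s u})}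

/-- For `k ≥ 1`, the `k`-th smallest eigenvalue `λ_k`, counted with multiplicity, of the
fractional Laplacian `(-Δ)^{α/2}` on `Ω` with Dirichlet condition outside `Ω`. -/
def fracEigenvalue (α : ℝ) (Ω : Set Plane) (k : ℕ) : ℝ := sInf (eigenvalueLevels α Ω k)

/-- `(λ₁ + ⋯ + λ_n)^{2/α} · A · (A / L²)`. -/
def isoperimetricSpectralQuantity (α : ℝ) (n : ℕ) (E : Set Plane) : ℝ :=
  (∑ k ∈ Finset.Icc 1 n, fracEigenvalue α E k) ^ (2 / α) * area E * (area E / perimeter E ^ 2)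

end

/-! Disk eigenfunctions, transplanted by affine maps, serve as trial functions on the ellipse, and
the resulting bounds are averaged over rotations of the disk. Let u_1, …, u_n be L²-orthonormal in
H₀ of a disk of radius r, and let an affine map with linear part A take the ellipse with semiaxes a,
b onto that disk: A scales the axes by r/a and r/b and sends them to an orthonormal frame rotated by
θ. The normalised compositions are orthonormal on the ellipse, with energies ∫ |2π Aᵗη|^α |û_j(η)|²
dη. For every θ their total is at least the sum of the first n eigenvalues of the ellipse.

Averaging over θ replaces |Aᵗη|^α by |η|^α times the mean of q^α, where q(t) = ((r/a)² cos² t +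
(r/b)² sin² t)^{1/2}. Concavity of x ↦ x^α for α ≤ 1 bounds this mean by m^α, with m the mean of q.
But q is r/(ab) times the speed of the standard parametrisation of the ellipse, so m = rM/(2πab)
with M its length. Thus the eigenvalue sum of the ellipse is at most m^α times that of the disk, and
after raising to the power 2/α the factors of area and length cancel. The averaging needs no
symmetry of the disk eigenfunctions. The comparison is `sum_energy_le`, with Jensen's inequality in
`integral_rpow_radius_le`.

The spectral input is `exists_spectrum`. Since `besselOp` identifies L² isometrically with the
Sobolev space, the inclusion of H₀ into L² becomes an injective compact operator between Hilbert
spaces; singular values m_k correspond to eigenvalues 1/m_k² − 1, and `sum_inv_sq_le_sum_norm_sq` is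
the variational principle for sums. As the perimeter is a Hausdorff measure, two one-sided estimates
are used: M is at most the perimeter of the ellipse (`ellipseLength_le_perimeter`), and the circle
has perimeter at most 2πr (`hausdorffMeasure_frontier_ellipse_le`). -/

/-! ### Singular value decomposition of compact operators. -/

section CompactOperators

open Filter Topology

variable {G F : Type*} [NormedAddCommGroup G] [InnerProductSpace ℂ G] [CompleteSpace G]
  [NormedAddCommGroup F] [InnerProductSpace ℂ F] [CompleteSpace F]

/-- A nonzero compact operator between Hilbert spaces attains its norm, at a singular vector. -/
theorem exists_singularVector_of_isCompactOperator (T : G →L[ℂ] F) (hT : IsCompactOperator T)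
    (h0 : 0 < ‖T‖) :
    ∃ g : G, ‖g‖ = 1 ∧ ∀ v, inner ℂ (T g) (T v) = ((‖T‖ : ℝ) : ℂ) ^ 2 * inner ℂ g v := by
  set m := ‖T‖ with hm
  have hex : ∀ n : ℕ, ∃ x : G, ‖x‖ < 1 ∧ m - 1 / ((n : ℝ) + 1) < ‖T x‖ := fun n =>
    T.exists_lt_apply_of_lt_opNorm (by
      have : (0 : ℝ) < 1 / ((n : ℝ) + 1) := by positivity
      linarith)
  choose x hx1 hx2 using hex
  have hxle : ∀ n, ‖T (x n)‖ ≤ m := fun n =>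
    (T.le_opNorm _).trans (by nlinarith [hx1 n, norm_nonneg (x n)])
  have hlim : Tendsto (fun n => ‖T (x n)‖) atTop (𝓝 m) := by
    refine tendsto_of_tendsto_of_tendsto_of_le_of_le (g := fun n : ℕ => m - 1 / ((n : ℝ) + 1))
      ?_ tendsto_const_nhds (fun n => (hx2 n).le) hxle
    simpa using tendsto_const_nhds.sub (tendsto_one_div_add_atTop_nhds_zero_nat (𝕜 := ℝ))
  have hc := IsCompactOperator.isCompact_closure_image_closedBall (f := (T : G →ₗ[ℂ] F)) hT 1
  obtain ⟨y, -, φ, hφ, hy⟩ := hc.tendsto_subseq (x := fun n => T (x n))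
    (fun n => subset_closure ⟨x n, by simpa using (hx1 n).le, rfl⟩)
  have hlim' := hlim.comp hφ.tendsto_atTop
  set S := ContinuousLinearMap.adjoint T with hS
  have hSy : Tendsto (fun n => S (T (x (φ n)))) atTop (𝓝 (S y)) := (S.continuous.tendsto y).comp hy
  -- Along a maximising sequence the right side tends to 0, so x is asymptotically an eigenvector of
  -- T*T. Convergence of T x along a subsequence then forces convergence of x itself.
  have key : ∀ n, ‖S (T (x n)) - ((m : ℝ) : ℂ) ^ 2 • x n‖ ^ 2 ≤ m ^ 4 - m ^ 2 * ‖T (x n)‖ ^ 2 := by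
    intro n
    have h1 : ‖S (T (x n))‖ ≤ m * ‖T (x n)‖ := by
      have := S.le_opNorm (T (x n))
      rwa [hS, LinearIsometryEquiv.norm_map] at this
    have h2 : RCLike.re (inner ℂ (S (T (x n))) (((m : ℝ) : ℂ) ^ 2 • x n)) =
        m ^ 2 * ‖T (x n)‖ ^ 2 := by
      rw [inner_smul_right, hS, ContinuousLinearMap.adjoint_inner_left,
        inner_self_eq_norm_sq_to_K]
      have : ((m : ℝ) : ℂ) ^ 2 * ((‖T (x n)‖ : ℝ) : ℂ) ^ 2 =
          ((m ^ 2 * ‖T (x n)‖ ^ 2 : ℝ) : ℂ) := by push_cast; rfl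
      exact (congrArg Complex.re this).trans (Complex.ofReal_re _)
    have h3 : ‖((m : ℝ) : ℂ) ^ 2 • x n‖ ≤ m ^ 2 := by
      rw [norm_smul, norm_pow, Complex.norm_real, Real.norm_of_nonneg h0.le]
      nlinarith [hx1 n, norm_nonneg (x n), sq_nonneg m]
    rw [@norm_sub_sq ℂ, h2]
    have h4 : ‖S (T (x n))‖ ^ 2 ≤ (m * ‖T (x n)‖) ^ 2 := by gcongr
    have h5 : ‖((m : ℝ) : ℂ) ^ 2 • x n‖ ^ 2 ≤ (m ^ 2) ^ 2 := by gcongr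
    nlinarith
  have hm0 : (((m : ℝ) : ℂ) ^ 2) ≠ 0 := by
    have : (m : ℂ) ≠ 0 := by exact_mod_cast h0.ne'
    positivity
  have hdiff : Tendsto (fun n => S (T (x (φ n))) - ((m : ℝ) : ℂ) ^ 2 • x (φ n)) atTop (𝓝 0) := by
    rw [tendsto_zero_iff_norm_tendsto_zero]
    have h1 : Tendsto (fun n => m ^ 4 - m ^ 2 * ‖T (x (φ n))‖ ^ 2) atTop (𝓝 0) := by
      have := (tendsto_const_nhds (x := m ^ 4)).sub ((hlim'.pow 2).const_mul (m ^ 2))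
      rw [show m ^ 4 - m ^ 2 * m ^ 2 = 0 by ring] at this
      exact this
    have h2 := squeeze_zero (fun n => sq_nonneg _) (fun n => key (φ n)) h1
    have h3 := h2.sqrt
    simpa [Real.sqrt_sq] using h3
  have hx' : Tendsto (fun n => ((m : ℝ) : ℂ) ^ 2 • x (φ n)) atTop (𝓝 (S y)) := by
    simpa using hSy.sub hdiff
  set g := (((m : ℝ) : ℂ) ^ 2)⁻¹ • S y with hg
  have hxg : Tendsto (fun n => x (φ n)) atTop (𝓝 g) := by
    have := hx'.const_smul (((m : ℝ) : ℂ) ^ 2)⁻¹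
    simpa [smul_smul, inv_mul_cancel₀ hm0] using this
  have hTg : T g = y := tendsto_nhds_unique ((T.continuous.tendsto g).comp hxg) hy
  have hny : ‖T g‖ = m := by
    rw [hTg]; exact tendsto_nhds_unique hy.norm hlim'
  have hg1 : ‖g‖ ≤ 1 := le_of_tendsto hxg.norm (Eventually.of_forall fun n => (hx1 _).le)
  refine ⟨g, le_antisymm hg1 ?_, fun v => ?_⟩
  · have := T.le_opNorm g
    rw [hny, ← hm] at this
    nlinarith
  · have h1 : S (T g) = ((m : ℝ) : ℂ) ^ 2 • g := by
      rw [hTg, hg, smul_smul, mul_inv_cancel₀ hm0, one_smul]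
    rw [← ContinuousLinearMap.adjoint_inner_left, ← hS, h1, inner_smul_left]
    simp

/-- The singular value decomposition of an injective compact operator on an infinite-dimensional
Hilbert space, with decreasing singular values. -/
theorem exists_singularSystem (J : G →L[ℂ] F) (hJ : IsCompactOperator J)
    (hinj : Function.Injective J) (hdim : ¬ FiniteDimensional ℂ G) :
    ∃ (e : ℕ → G) (m : ℕ → ℝ), (∀ k, 0 < m k) ∧ Antitone m ∧ Orthonormal ℂ e ∧
      (∀ k v, inner ℂ (J (e k)) (J v) = ((m k : ℝ) : ℂ) ^ 2 * inner ℂ (e k) v) ∧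
      ∀ k v, (∀ i < k, inner ℂ (e i) v = 0) → ‖J v‖ ≤ m k * ‖v‖ := by
  have step : ∀ W : Submodule ℂ G, FiniteDimensional ℂ W →
      ∃ g ∈ Wᗮ, ‖g‖ = 1 ∧ 0 < ‖J ∘L (Wᗮ).subtypeL‖ ∧ ∀ v ∈ Wᗮ,
        inner ℂ (J g) (J v) = ((‖J ∘L (Wᗮ).subtypeL‖ : ℝ) : ℂ) ^ 2 * inner ℂ g v := by
    intro W hW
    -- If J vanished on the orthogonal complement of W, injectivity would make the complement
    -- trivial and the whole space equal to the finite-dimensional W.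
    have hpos : 0 < ‖J ∘L (Wᗮ).subtypeL‖ := by
      refine (ContinuousLinearMap.opNorm_nonneg _).lt_of_ne' fun h0 => hdim ?_
      have h := (ContinuousLinearMap.opNorm_zero_iff (J ∘L (Wᗮ).subtypeL)).1 h0
      have hbot : Wᗮ = ⊥ := by
        rw [Submodule.eq_bot_iff]
        intro v hv
        have : J v = 0 := by simpa using DFunLike.congr_fun h ⟨v, hv⟩
        exact hinj (by simpa using this)
      rw [Submodule.orthogonal_eq_bot_iff] at hbot
      subst hbot
      exact Module.Finite.equiv (Submodule.topEquiv (R := ℂ) (M := G))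
    obtain ⟨g, hg1, hg2⟩ := exists_singularVector_of_isCompactOperator (J ∘L (Wᗮ).subtypeL)
      (hJ.comp_clm _) hpos
    exact ⟨g, g.2, hg1, hpos, fun v hv => hg2 ⟨v, hv⟩⟩
  choose! g hgW hg1 hpos hg using step
  obtain ⟨S, hS0, hS⟩ : ∃ S : ℕ → Submodule ℂ G, S 0 = ⊥ ∧
      ∀ k, S (k + 1) = S k ⊔ Submodule.span ℂ {g (S k)} :=
    ⟨fun k => Nat.rec ⊥ (fun _ W => W ⊔ Submodule.span ℂ {g W}) k, rfl, fun _ => rfl⟩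
  have hfin : ∀ k, FiniteDimensional ℂ ↥(S k) := by
    intro k
    induction k with
    | zero => rw [hS0]; infer_instance
    | succ k ih =>
      rw [hS]
      infer_instance
  have hmono : Monotone S := monotone_nat_of_le_succ fun k => by rw [hS]; exact le_sup_left
  have hmem : ∀ i k, i < k → g (S i) ∈ S k := fun i k hik =>
    hmono (Nat.succ_le_of_lt hik) (by
      rw [Nat.succ_eq_add_one, hS]
      exact Submodule.mem_sup_right (Submodule.mem_span_singleton_self _))
  have horth : ∀ k v, (∀ i < k, inner ℂ (g (S i)) v = 0) → v ∈ (S k)ᗮ := by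
    intro k v
    induction k with
    | zero => intro _; simp [hS0]
    | succ k ih =>
      intro h
      rw [hS, ← Submodule.inf_orthogonal]
      exact ⟨ih fun i hi => h i (by omega),
        Submodule.mem_orthogonal_singleton_iff_inner_right.2 (h k (by omega))⟩
  have hg0 : ∀ i k, i < k → inner ℂ (g (S i)) (g (S k)) = 0 := fun i k hik =>
    Submodule.inner_right_of_mem_orthogonal (hmem i k hik) (hgW _ (hfin k))
  let m : ℕ → ℝ := fun k => ‖J ∘L ((S k)ᗮ).subtypeL‖
  have hbound : ∀ k, ∀ v ∈ (S k)ᗮ, ‖J v‖ ≤ m k * ‖v‖ := fun k v hv =>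
    (J ∘L ((S k)ᗮ).subtypeL).le_opNorm ⟨v, hv⟩
  -- By construction the relation is known only for v orthogonal to the earlier vectors. On their
  -- span both sides vanish, by the relations already obtained for smaller indices.
  have heig : ∀ k, ∀ v, inner ℂ (J (g (S k))) (J v) = ((m k : ℝ) : ℂ) ^ 2 * inner ℂ (g (S k)) v := by
    intro k
    induction k using Nat.strong_induction_on with
    | _ k ih =>
      intro v
      have hzero : ∀ w ∈ S k, inner ℂ (J (g (S k))) (J w) = 0 := by
        have : ∀ j ≤ k, ∀ w ∈ S j, inner ℂ (J (g (S k))) (J w) = 0 := by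
          intro j
          induction j with
          | zero =>
            intro _ w hw
            have : w = 0 := by simpa [hS0] using hw
            simp [this]
          | succ j ihj =>
            intro hj w hw
            rw [hS, Submodule.mem_sup] at hw
            obtain ⟨a, ha, b, hb, rfl⟩ := hw
            obtain ⟨c, rfl⟩ := Submodule.mem_span_singleton.1 hb
            rw [map_add, inner_add_right, ihj (by omega) a ha, map_smul, inner_smul_right,
              ← inner_conj_symm, ih j (by omega), hg0 j k (by omega)]
            simp
        exact this k le_rfl
      have := hfin k
      obtain ⟨a, ha, b, hb, rfl⟩ := (S k).exists_add_mem_mem_orthogonal v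
      rw [map_add, inner_add_right, hzero a ha, inner_add_right,
        Submodule.inner_left_of_mem_orthogonal ha (hgW _ (hfin k)), hg _ (hfin k) b hb]
      simp [m]
  refine ⟨fun k => g (S k), m, fun k => hpos _ (hfin k), ?_, ?_, heig, ?_⟩
  · intro i k hik
    refine ContinuousLinearMap.opNorm_le_bound _ (ContinuousLinearMap.opNorm_nonneg _) fun v => ?_
    exact hbound i v (Submodule.orthogonal_le (hmono hik) v.2)
  · refine ⟨fun k => hg1 _ (hfin k), fun i k hik => ?_⟩
    rcases lt_or_gt_of_ne hik with h | h
    · exact hg0 i k h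
    · rw [← inner_conj_symm, hg0 k i h, map_zero]
  · exact fun k v hv => hbound k v (horth k v hv)

end CompactOperators

/-! ### Variational principles for singular systems. -/

section SingularSystems

variable {G F : Type*} [NormedAddCommGroup G] [InnerProductSpace ℂ G]
  [NormedAddCommGroup F] [InnerProductSpace ℂ F]

theorem inner_sub_sum_eq_zero {e : ℕ → G} (he : Orthonormal ℂ e) (g : G) {k i : ℕ} (hi : i < k) :
    inner ℂ (e i) (g - ∑ j ∈ Finset.range k, (inner ℂ (e j) g : ℂ) • e j) = 0 := by
  rw [inner_sub_right, he.inner_right_sum (fun j => (inner ℂ (e j) g : ℂ)) (Finset.mem_range.2 hi),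
    sub_self]

theorem norm_sq_eq_sum_add_norm_sub_sq {e : ℕ → G} (he : Orthonormal ℂ e) (n : ℕ) (g : G) :
    ‖g‖ ^ 2 = ∑ i ∈ Finset.range n, ‖(inner ℂ (e i) g : ℂ)‖ ^ 2 +
      ‖g - ∑ i ∈ Finset.range n, (inner ℂ (e i) g : ℂ) • e i‖ ^ 2 := by
  set P := ∑ i ∈ Finset.range n, (inner ℂ (e i) g : ℂ) • e i with hP
  have h1 : inner ℂ P (g - P) = 0 := by
    nth_rewrite 1 [hP]
    rw [sum_inner]
    refine Finset.sum_eq_zero fun i hi => ?_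
    rw [inner_smul_left, inner_sub_sum_eq_zero he g (Finset.mem_range.1 hi), mul_zero]
  have h2 : ‖P‖ ^ 2 = ∑ i ∈ Finset.range n, ‖(inner ℂ (e i) g : ℂ)‖ ^ 2 := by
    have h3 : inner ℂ P P = ((∑ i ∈ Finset.range n, ‖(inner ℂ (e i) g : ℂ)‖ ^ 2 : ℝ) : ℂ) := by
      rw [hP, he.inner_sum]
      push_cast
      exact Finset.sum_congr rfl fun i _ => Complex.conj_mul' _
    rw [inner_self_eq_norm_sq_to_K] at h3
    have h4 : ((‖P‖ ^ 2 : ℝ) : ℂ) =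
        ((∑ i ∈ Finset.range n, ‖(inner ℂ (e i) g : ℂ)‖ ^ 2 : ℝ) : ℂ) := by
      rw [← h3]; push_cast; rfl
    exact Complex.ofReal_injective h4
  have h5 := norm_add_sq_eq_norm_sq_add_norm_sq_of_inner_eq_zero (𝕜 := ℂ) P (g - P) h1
  rw [add_sub_cancel] at h5
  rw [← h2]
  nlinarith

/-- Division by m k compensates for ‖J (e k)‖ = m k. In the application these images are the
L²-normalised eigenfunctions. -/
theorem orthonormal_smul_singular {J : G →L[ℂ] F} {e : ℕ → G} {m : ℕ → ℝ} (hm : ∀ k, 0 < m k)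
    (he : Orthonormal ℂ e)
    (hJ : ∀ k v, inner ℂ (J (e k)) (J v) = ((m k : ℝ) : ℂ) ^ 2 * inner ℂ (e k) v) :
    Orthonormal ℂ (fun k => J (((m k : ℝ) : ℂ)⁻¹ • e k)) := by
  have hm' : ∀ k, ((m k : ℝ) : ℂ) ≠ 0 := fun k => by exact_mod_cast (hm k).ne'
  rw [orthonormal_iff_ite] at he ⊢
  intro i j
  rw [map_smul, map_smul, inner_smul_left, inner_smul_right, hJ, he]
  split_ifs with h
  · subst h
    simp only [map_inv₀, Complex.conj_ofReal]
    field_simp [hm' i]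
  · simp

/-- The weak eigenvectors with eigenvalue at most `t` span a space of dimension greater than `k`
exactly if `t` is at least the `k`-th number `1 / m k ^ 2 - 1`. -/
theorem lt_rank_span_eigenvectors_iff {J : G →L[ℂ] F} {e : ℕ → G} {m : ℕ → ℝ}
    (hm : ∀ k, 0 < m k) (hanti : Antitone m) (he : Orthonormal ℂ e)
    (hJ : ∀ k v, inner ℂ (J (e k)) (J v) = ((m k : ℝ) : ℂ) ^ 2 * inner ℂ (e k) v)
    (hmax : ∀ k v, (∀ i < k, inner ℂ (e i) v = 0) → ‖J v‖ ≤ m k * ‖v‖) (k : ℕ) (t : ℝ) :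
    ((k + 1 : ℕ) : Cardinal) ≤ Module.rank ℂ (Submodule.span ℂ {u : F | ∃ s ≤ t, ∃ g, J g = u ∧
      ∀ h, inner ℂ h g = (1 + (s : ℂ)) * inner ℂ (J h) (J g)}) ↔ 1 / m k ^ 2 - 1 ≤ t := by
  have hm' : ∀ k, ((m k : ℝ) : ℂ) ≠ 0 := fun k => by exact_mod_cast (hm k).ne'
  have hJ' : ∀ k v, inner ℂ (J v) (J (e k)) = ((m k : ℝ) : ℂ) ^ 2 * inner ℂ v (e k) := by
    intro k v
    rw [← inner_conj_symm, hJ, map_mul, inner_conj_symm, map_pow, Complex.conj_ofReal]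
  constructor
  · classical
    intro hrank
    by_contra! hlt
    have hsub : {u : F | ∃ s ≤ t, ∃ g, J g = u ∧
        ∀ h, inner ℂ h g = (1 + (s : ℂ)) * inner ℂ (J h) (J g)} ⊆
        Submodule.span ℂ (((Finset.range k).image (fun i => J (e i)) : Finset F) : Set F) := by
      rintro u ⟨s, hst, g, rfl, hg⟩
      set P := ∑ j ∈ Finset.range k, (inner ℂ (e j) g : ℂ) • e j with hP
      set r := g - P with hr
      have h0 : ∀ i < k, inner ℂ (e i) r = 0 := fun i hi => inner_sub_sum_eq_zero he g hi
      have h0' : ∀ i < k, inner ℂ r (e i) = 0 := fun i hi => by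
        rw [← inner_conj_symm, h0 i hi, map_zero]
      have hJr := hmax k r h0
      have hrP : inner ℂ r P = 0 := by
        rw [hP, inner_sum]
        refine Finset.sum_eq_zero fun i hi => ?_
        rw [inner_smul_right, h0' i (Finset.mem_range.1 hi), mul_zero]
      have hJrP : inner ℂ (J r) (J P) = 0 := by
        rw [hP, map_sum, inner_sum]
        refine Finset.sum_eq_zero fun i hi => ?_
        rw [map_smul, inner_smul_right, hJ', h0' i (Finset.mem_range.1 hi), mul_zero, mul_zero]
      have hrr : inner ℂ r r = (1 + (s : ℂ)) * inner ℂ (J r) (J r) := by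
        have h1 : inner ℂ r g = inner ℂ r r := by
          rw [show g = r + P by rw [hr, sub_add_cancel], inner_add_right, hrP, add_zero]
        have h2 : inner ℂ (J r) (J g) = inner ℂ (J r) (J r) := by
          rw [show g = r + P by rw [hr, sub_add_cancel], map_add, inner_add_right, hJrP, add_zero]
        rw [← h1, ← h2, hg]
      have hrr' : ‖r‖ ^ 2 = (1 + s) * ‖J r‖ ^ 2 := by
        rw [inner_self_eq_norm_sq_to_K, inner_self_eq_norm_sq_to_K] at hrr
        have h3 : ((‖r‖ ^ 2 : ℝ) : ℂ) = (((1 + s) * ‖J r‖ ^ 2 : ℝ) : ℂ) := by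
          push_cast; exact hrr
        exact Complex.ofReal_injective h3
      -- The part r of g orthogonal to the first k singular vectors satisfies ‖r‖² = (1 + s)‖J r‖²
      -- with ‖J r‖ ≤ m k ‖r‖, so this strict inequality forces r = 0.
      have hsm : (1 + s) * m k ^ 2 < 1 := by
        have h1 : 1 + s < 1 / m k ^ 2 := by linarith
        have h2 : 0 < m k ^ 2 := pow_pos (hm k) 2
        rwa [lt_div_iff₀ h2] at h1
      have hr0 : ‖r‖ = 0 := by
        by_contra hne
        have hpos : 0 < ‖r‖ ^ 2 := by positivity
        have hsq : ‖J r‖ ^ 2 ≤ m k ^ 2 * ‖r‖ ^ 2 := by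
          rw [← mul_pow]; gcongr
        rcases le_or_gt (1 + s) 0 with h | h
        · nlinarith [sq_nonneg ‖J r‖]
        · nlinarith
      have hg' : g = P := by
        rw [norm_eq_zero, hr, sub_eq_zero] at hr0
        exact hr0
      rw [hg', hP, map_sum]
      refine Submodule.sum_mem _ fun i hi => ?_
      rw [map_smul]
      exact Submodule.smul_mem _ _ (Submodule.subset_span (Finset.mem_coe.2
        (Finset.mem_image_of_mem (fun i => J (e i)) hi)))
    have h1 := hrank.trans ((Submodule.rank_mono (Submodule.span_le.2 hsub)).trans
      (rank_span_finset_le _))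
    have h2 : ((Finset.range k).image (fun i => J (e i))).card ≤ k :=
      Finset.card_image_le.trans (Finset.card_range k).le
    have h3 : k + 1 ≤ ((Finset.range k).image (fun i => J (e i))).card := by exact_mod_cast h1
    omega
  · intro ht
    have hli : LinearIndependent ℂ (fun i : Fin (k + 1) => J (((m i : ℝ) : ℂ)⁻¹ • e i)) :=
      ((orthonormal_smul_singular hm he hJ).comp _ Fin.val_injective).linearIndependent
    have hsub : Set.range (fun i : Fin (k + 1) => J (((m i : ℝ) : ℂ)⁻¹ • e i)) ⊆
        {u : F | ∃ s ≤ t, ∃ g, J g = u ∧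
          ∀ h, inner ℂ h g = (1 + (s : ℂ)) * inner ℂ (J h) (J g)} := by
      rintro _ ⟨i, rfl⟩
      -- The singular relation for e i is the eigenvector equation with 1 + s = 1 / m i ^ 2.
      refine ⟨1 / m i ^ 2 - 1, ?_, _, rfl, fun h => ?_⟩
      · refine le_trans ?_ ht
        have h1 := hanti (Nat.le_of_lt_succ i.2)
        have h2 := hm k
        gcongr
      · rw [map_smul, inner_smul_right, inner_smul_right, hJ']
        push_cast
        field_simp [hm' i]
        ring
    have h1 := Submodule.rank_mono (Submodule.span_mono (R := ℂ) hsub)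
    have : Module.Finite ℂ ↥(Submodule.span ℂ
        (Set.range (fun i : Fin (k + 1) => J (((m i : ℝ) : ℂ)⁻¹ • e i)))) :=
      Module.Finite.span_of_finite ℂ (Set.finite_range _)
    rw [← Module.finrank_eq_rank, finrank_span_eq_card hli, Fintype.card_fin] at h1
    exact h1

/-- Among all families whose images are orthonormal, the sum of the squared norms is smallest for
the singular vectors. -/
theorem sum_inv_sq_le_sum_norm_sq {J : G →L[ℂ] F} {e : ℕ → G} {m : ℕ → ℝ}
    (hm : ∀ k, 0 < m k) (hanti : Antitone m) (he : Orthonormal ℂ e)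
    (hJ : ∀ k v, inner ℂ (J (e k)) (J v) = ((m k : ℝ) : ℂ) ^ 2 * inner ℂ (e k) v)
    (hmax : ∀ k v, (∀ i < k, inner ℂ (e i) v = 0) → ‖J v‖ ≤ m k * ‖v‖) (n : ℕ) (v : Fin n → G)
    (hv : Orthonormal ℂ (fun j => J (v j))) :
    ∑ k ∈ Finset.range n, 1 / m k ^ 2 ≤ ∑ j, ‖v j‖ ^ 2 := by
  have hm' : ∀ k, ((m k : ℝ) : ℂ) ≠ 0 := fun k => by exact_mod_cast (hm k).ne'
  have hf := orthonormal_smul_singular hm he hJ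
  set f : ℕ → F := fun k => J (((m k : ℝ) : ℂ)⁻¹ • e k) with hfdef
  have hfe : ∀ i g, ‖inner ℂ (e i) g‖ ^ 2 = 1 / m i ^ 2 * ‖inner ℂ (f i) (J g)‖ ^ 2 := by
    intro i g
    have h2 := (hm i).ne'
    rw [hfdef]
    simp only [map_smul, inner_smul_left, hJ, norm_mul, RCLike.norm_conj, norm_inv, norm_pow,
      Complex.norm_real, Real.norm_of_nonneg (hm i).le]
    field_simp
  -- The first n coordinates of g carry weights 1 / m i ^ 2 relative to J g, and the remainder
  -- carries weight at least 1 / m n ^ 2. The bound is written as a deviation from this common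
  -- threshold.
  have hone : ∀ g, ∑ i ∈ Finset.range n, (1 / m i ^ 2 - 1 / m n ^ 2) * ‖inner ℂ (f i) (J g)‖ ^ 2 +
      1 / m n ^ 2 * ‖J g‖ ^ 2 ≤ ‖g‖ ^ 2 := by
    intro g
    have h1 := norm_sq_eq_sum_add_norm_sub_sq he n g
    have h2 := norm_sq_eq_sum_add_norm_sub_sq hf n (J g)
    set r := g - ∑ i ∈ Finset.range n, (inner ℂ (e i) g : ℂ) • e i with hr
    have hJr := hmax n r fun i hi => inner_sub_sum_eq_zero he g hi
    have h3 : J g - ∑ i ∈ Finset.range n, (inner ℂ (f i) (J g) : ℂ) • f i = J r := by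
      rw [hr, map_sub, map_sum]
      congr 1
      refine Finset.sum_congr rfl fun i _ => ?_
      rw [hfdef]
      simp only [map_smul, inner_smul_left, hJ, smul_smul, map_inv₀, Complex.conj_ofReal]
      congr 1
      field_simp [hm' i]
    rw [h3] at h2
    have h4 : 1 / m n ^ 2 * ‖J r‖ ^ 2 ≤ ‖r‖ ^ 2 := by
      have : ‖J r‖ ^ 2 ≤ (m n * ‖r‖) ^ 2 := by gcongr
      have h5 := pow_pos (hm n) 2
      rw [one_div, inv_mul_le_iff₀ h5, ← mul_pow]
      exact this
    rw [h1, h2, mul_add]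
    simp_rw [hfe, sub_mul, Finset.sum_sub_distrib, ← Finset.mul_sum]
    linarith
  -- Bessel's inequality for the family J (v j), tested on the unit vector f i.
  have hS : ∀ i, ∑ j, ‖inner ℂ (f i) (J (v j))‖ ^ 2 ≤ 1 := by
    intro i
    have := hv.sum_inner_products_le (x := f i) (s := Finset.univ)
    rw [hf.1 i, one_pow] at this
    simpa only [norm_inner_symm] using this
  -- The coefficients 1 / m i ^ 2 - 1 / m n ^ 2 are nonpositive, so multiplying them by the Bessel
  -- sums, which are at most 1, can only increase the total.
  calc ∑ k ∈ Finset.range n, 1 / m k ^ 2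
      = ∑ i ∈ Finset.range n, (1 / m i ^ 2 - 1 / m n ^ 2) + n * (1 / m n ^ 2) := by
        simp
    _ ≤ ∑ i ∈ Finset.range n, (1 / m i ^ 2 - 1 / m n ^ 2) * ∑ j, ‖inner ℂ (f i) (J (v j))‖ ^ 2 +
          n * (1 / m n ^ 2) := by
        gcongr with i hi
        have h1 : 1 / m i ^ 2 ≤ 1 / m n ^ 2 := by
          have h2 := hanti (Finset.mem_range.1 hi).le
          have h3 := hm n
          gcongr
        nlinarith [hS i]
    _ = ∑ j, (∑ i ∈ Finset.range n, (1 / m i ^ 2 - 1 / m n ^ 2) * ‖inner ℂ (f i) (J (v j))‖ ^ 2 +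
          1 / m n ^ 2 * ‖J (v j)‖ ^ 2) := by
        rw [Finset.sum_add_distrib, Finset.sum_comm]
        simp_rw [Finset.mul_sum, hv.1]
        simp
    _ ≤ ∑ j, ‖v j‖ ^ 2 := Finset.sum_le_sum fun j _ => hone _

end SingularSystems

/-! ### Multiplication operators on L². -/

section MultiplicationOperators

theorem memLp_bounded_mul {m : Plane → ℂ} (hm : Measurable m) {C : ℝ} (hC : ∀ x, ‖m x‖ ≤ C)
    (u : L2Plane) : MemLp (fun x => m x * u x) 2 (volume : Measure Plane) :=
  (Lp.memLp u).of_le_mul (c := C) (hm.aestronglyMeasurable.mul (Lp.aestronglyMeasurable u))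
    (Filter.Eventually.of_forall fun x => by
      rw [norm_mul]
      exact mul_le_mul_of_nonneg_right (hC x) (norm_nonneg _))

/-- Multiplication of an `L²` function by a measurable function bounded by `C`. -/
noncomputable def mulOp (m : Plane → ℂ) (hm : Measurable m) (C : ℝ) (hC : ∀ x, ‖m x‖ ≤ C) :
    L2Plane →L[ℂ] L2Plane :=
  LinearMap.mkContinuous
    { toFun := fun u => (memLp_bounded_mul hm hC u).toLp
      map_add' := fun u v => by
        apply Lp.ext
        filter_upwards [(memLp_bounded_mul hm hC (u + v)).coeFn_toLp, (memLp_bounded_mul hm hC u).coeFn_toLp, (memLp_bounded_mul hm hC v).coeFn_toLp,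
          Lp.coeFn_add u v, Lp.coeFn_add (memLp_bounded_mul hm hC u).toLp (memLp_bounded_mul hm hC v).toLp] with x h1 h2 h3 h4 h5
        rw [h1, h5, Pi.add_apply, h2, h3, h4, Pi.add_apply, mul_add]
      map_smul' := fun c u => by
        apply Lp.ext
        filter_upwards [(memLp_bounded_mul hm hC (c • u)).coeFn_toLp, (memLp_bounded_mul hm hC u).coeFn_toLp,
          Lp.coeFn_smul c u, Lp.coeFn_smul c (memLp_bounded_mul hm hC u).toLp] with x h1 h2 h3 h4
        rw [h1, RingHom.id_apply, h4, Pi.smul_apply, h2, h3, Pi.smul_apply, smul_eq_mul,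
          smul_eq_mul]
        ring }
    C fun u => by
      refine Lp.norm_le_mul_norm_of_ae_le_mul ?_
      filter_upwards [(memLp_bounded_mul hm hC u).coeFn_toLp] with x h1
      rw [LinearMap.coe_mk, AddHom.coe_mk, h1, norm_mul]
      exact mul_le_mul_of_nonneg_right (hC x) (norm_nonneg _)

theorem coeFn_mulOp (m : Plane → ℂ) (hm : Measurable m) (C : ℝ) (hC : ∀ x, ‖m x‖ ≤ C)
    (u : L2Plane) : mulOp m hm C hC u =ᵐ[volume] fun x => m x * u x :=
  (memLp_bounded_mul hm hC u).coeFn_toLp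

theorem norm_mulOp_le (m : Plane → ℂ) (hm : Measurable m) (C : ℝ) (hC : ∀ x, ‖m x‖ ≤ C) :
    ‖mulOp m hm C hC‖ ≤ C :=
  LinearMap.mkContinuous_norm_le _ ((norm_nonneg _).trans (hC 0)) _

theorem ofReal_norm_sq_eq_lintegral (u : L2Plane) :
    ENNReal.ofReal (‖u‖ ^ 2) = ∫⁻ x, ENNReal.ofReal (‖u x‖ ^ 2) := by
  have h := L2.integrable_inner (𝕜 := ℂ) u u
  have h1 : ∀ x, inner ℂ (u x) (u x) = ((‖u x‖ ^ 2 : ℝ) : ℂ) := fun x => by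
    rw [inner_self_eq_norm_sq_to_K]; push_cast; rfl
  simp_rw [h1] at h
  have h2 : Integrable (fun x => ‖u x‖ ^ 2) (volume : Measure Plane) := by
    exact h.re
  rw [← ofReal_integral_eq_lintegral_ofReal h2 (Filter.Eventually.of_forall fun x => by positivity)]
  congr 1
  have h3 : inner ℂ u u = ((‖u‖ ^ 2 : ℝ) : ℂ) := by
    rw [inner_self_eq_norm_sq_to_K]; push_cast; rfl
  rw [L2.inner_def] at h3
  simp_rw [h1] at h3
  rw [integral_complex_ofReal] at h3
  exact (Complex.ofReal_injective h3).symm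

end MultiplicationOperators

/-! ### The Bessel potential as an isometry onto the Sobolev space. -/

section BesselPotential

theorem fracSymbol_nonneg (α : ℝ) (ξ : Plane) : 0 ≤ fracSymbol α ξ := by
  unfold fracSymbol; positivity

theorem measurable_fracSymbol (α : ℝ) : Measurable (fracSymbol α) := by
  unfold fracSymbol; fun_prop

/-- The weight `(1 + |2πξ|^α)^{1/2}` of the Sobolev norm. -/
noncomputable def sobolevWeight (α : ℝ) (ξ : Plane) : ℝ := √(1 + fracSymbol α ξ)

theorem one_le_sobolevWeight (α : ℝ) (ξ : Plane) : 1 ≤ sobolevWeight α ξ := by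
  rw [sobolevWeight, Real.one_le_sqrt]
  linarith [fracSymbol_nonneg α ξ]

theorem sobolevWeight_pos (α : ℝ) (ξ : Plane) : 0 < sobolevWeight α ξ :=
  zero_lt_one.trans_le (one_le_sobolevWeight α ξ)

theorem sobolevWeight_sq (α : ℝ) (ξ : Plane) : sobolevWeight α ξ ^ 2 = 1 + fracSymbol α ξ :=
  Real.sq_sqrt (by linarith [fracSymbol_nonneg α ξ])

theorem measurable_sobolevWeight (α : ℝ) : Measurable (sobolevWeight α) :=
  (measurable_const.add (measurable_fracSymbol α)).sqrt

theorem measurable_inv_sobolevWeight (α : ℝ) :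
    Measurable fun ξ => (((sobolevWeight α ξ)⁻¹ : ℝ) : ℂ) :=
  Complex.measurable_ofReal.comp (measurable_sobolevWeight α).inv

theorem norm_inv_sobolevWeight_le (α : ℝ) (ξ : Plane) :
    ‖(((sobolevWeight α ξ)⁻¹ : ℝ) : ℂ)‖ ≤ 1 := by
  rw [Complex.norm_real, norm_inv, Real.norm_of_nonneg (sobolevWeight_pos α ξ).le]
  exact inv_le_one_of_one_le₀ (one_le_sobolevWeight α ξ)

/-- The Fourier transform on `L²` as a unitary operator. -/
noncomputable abbrev fourierL2 : L2Plane ≃ₗᵢ[ℂ] L2Plane := Lp.fourierTransformₗᵢ Plane ℂ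

/-- The operator `(1 + (-Δ)^{α/2})^{-1/2}` on `L²`. -/
noncomputable def besselOp (α : ℝ) : L2Plane →L[ℂ] L2Plane :=
  (fourierL2.symm.toContinuousLinearEquiv : L2Plane →L[ℂ] L2Plane) ∘L
    mulOp _ (measurable_inv_sobolevWeight α) 1 (norm_inv_sobolevWeight_le α)

theorem fourier_besselOp (α : ℝ) (g : L2Plane) :
    (𝓕 (besselOp α g) : L2Plane) = mulOp _ (measurable_inv_sobolevWeight α) 1
      (norm_inv_sobolevWeight_le α) g :=
  fourierL2.apply_symm_apply _

theorem coeFn_fourier_besselOp (α : ℝ) (g : L2Plane) :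
    (𝓕 (besselOp α g) : L2Plane) =ᵐ[volume] fun ξ => (((sobolevWeight α ξ)⁻¹ : ℝ) : ℂ) * g ξ := by
  rw [fourier_besselOp]
  exact coeFn_mulOp _ _ _ _ _

theorem norm_fourier_besselOp_sq {α : ℝ} {ξ : Plane} {z w : ℂ}
    (h : z = (((sobolevWeight α ξ)⁻¹ : ℝ) : ℂ) * w) :
    fracSymbol α ξ * ‖z‖ ^ 2 + ‖z‖ ^ 2 = ‖w‖ ^ 2 := by
  have h1 := (sobolevWeight_pos α ξ).ne'
  have h2 : fracSymbol α ξ = sobolevWeight α ξ ^ 2 - 1 := by rw [sobolevWeight_sq]; ring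
  rw [h, norm_mul, Complex.norm_real, norm_inv, Real.norm_of_nonneg (sobolevWeight_pos α ξ).le, h2]
  field_simp
  ring

/-- Plancherel turns the Sobolev norm into a weighted norm of the Fourier transform, and dividing by
`sobolevWeight` cancels the weight exactly. -/
theorem ofReal_norm_sq_add_fracEnergy_besselOp (α : ℝ) (g : L2Plane) :
    ENNReal.ofReal (‖besselOp α g‖ ^ 2) + fracEnergy α (besselOp α g) =
      ENNReal.ofReal (‖g‖ ^ 2) := by
  rw [← Lp.norm_fourier_eq (besselOp α g), ofReal_norm_sq_eq_lintegral,
    ofReal_norm_sq_eq_lintegral, fracEnergy, ← lintegral_add_left' ]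
  · refine lintegral_congr_ae ?_
    filter_upwards [coeFn_fourier_besselOp α g] with ξ h
    rw [← norm_fourier_besselOp_sq h, add_comm, ENNReal.ofReal_add]
    · exact mul_nonneg (fracSymbol_nonneg _ _) (by positivity)
    · positivity
  · exact ((Lp.aestronglyMeasurable _).norm.aemeasurable.pow_const 2).ennreal_ofReal

theorem besselOp_injective (α : ℝ) : Function.Injective (besselOp α) := by
  rw [injective_iff_map_eq_zero]
  intro g hg
  have h : mulOp _ (measurable_inv_sobolevWeight α) 1 (norm_inv_sobolevWeight_le α) g = 0 := by
    rw [← fourier_besselOp, hg]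
    exact map_zero fourierL2
  apply Lp.ext
  have h1 := coeFn_mulOp _ (measurable_inv_sobolevWeight α) 1 (norm_inv_sobolevWeight_le α) g
  rw [h] at h1
  filter_upwards [h1, Lp.coeFn_zero ℂ 2 (volume : Measure Plane)] with ξ h2 h3
  rw [h3, Pi.zero_apply] at h2
  rw [h3, Pi.zero_apply]
  rcases mul_eq_zero.1 h2.symm with h4 | h4
  · exact absurd (Complex.ofReal_eq_zero.1 h4) (inv_ne_zero (sobolevWeight_pos α ξ).ne')
  · exact h4

/-- The preimage is the Fourier transform of u multiplied by the weight; finite energy is what makes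
it square-integrable. -/
theorem exists_besselOp_eq_of_fracEnergy_ne_top {α : ℝ} {u : L2Plane} (hu : fracEnergy α u ≠ ⊤) :
    ∃ g, besselOp α g = u := by
  have hmeas : AEStronglyMeasurable (fun ξ => ((sobolevWeight α ξ : ℝ) : ℂ) * (𝓕 u : L2Plane) ξ)
      (volume : Measure Plane) :=
    (Complex.measurable_ofReal.comp (measurable_sobolevWeight α)).aestronglyMeasurable.mul
      (Lp.aestronglyMeasurable _)
  have hmem : MemLp (fun ξ => ((sobolevWeight α ξ : ℝ) : ℂ) * (𝓕 u : L2Plane) ξ) 2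
      (volume : Measure Plane) := by
    rw [memLp_two_iff_integrable_sq_norm hmeas]
    refine ⟨(hmeas.norm.pow 2), ?_⟩
    rw [hasFiniteIntegral_iff_ofReal (Filter.Eventually.of_forall fun ξ => by positivity)]
    have h1 : ∀ ξ, ENNReal.ofReal (‖((sobolevWeight α ξ : ℝ) : ℂ) * (𝓕 u : L2Plane) ξ‖ ^ 2) =
        ENNReal.ofReal (‖(𝓕 u : L2Plane) ξ‖ ^ 2) +
          ENNReal.ofReal (fracSymbol α ξ * ‖(𝓕 u : L2Plane) ξ‖ ^ 2) := fun ξ => by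
      rw [← ENNReal.ofReal_add (by positivity)
        (mul_nonneg (fracSymbol_nonneg _ _) (by positivity)), norm_mul, mul_pow, Complex.norm_real,
        Real.norm_of_nonneg (sobolevWeight_pos α ξ).le, sobolevWeight_sq]
      congr 1; ring
    simp_rw [h1]
    rw [lintegral_add_left'
      (((Lp.aestronglyMeasurable _).norm.aemeasurable.pow_const 2).ennreal_ofReal),
      ← ofReal_norm_sq_eq_lintegral]
    exact ENNReal.add_lt_top.2 ⟨ENNReal.ofReal_lt_top, hu.lt_top⟩
  refine ⟨hmem.toLp, ?_⟩
  apply fourierL2.injective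
  change (𝓕 (besselOp α hmem.toLp) : L2Plane) = (𝓕 u : L2Plane)
  apply Lp.ext
  filter_upwards [coeFn_fourier_besselOp α hmem.toLp, hmem.coeFn_toLp] with ξ h1 h2
  have h3 : ((sobolevWeight α ξ : ℝ) : ℂ) ≠ 0 := by exact_mod_cast (sobolevWeight_pos α ξ).ne'
  rw [h1, h2]
  push_cast
  rw [← mul_assoc, inv_mul_cancel₀ h3, one_mul]

/-- The symbol equals the squared weight minus 1. This polarised identity is what rewrites the weak
eigenvalue equation in terms of inner products only. -/
theorem fracForm_besselOp (α : ℝ) (g h : L2Plane) :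
    fracForm α (besselOp α g) (besselOp α h) =
      inner ℂ h g - inner ℂ (besselOp α h) (besselOp α g) := by
  rw [← Lp.inner_fourier_eq (besselOp α h), L2.inner_def, L2.inner_def, ← integral_sub
    (L2.integrable_inner _ _) (L2.integrable_inner _ _), fracForm]
  refine integral_congr_ae ?_
  filter_upwards [coeFn_fourier_besselOp α g, coeFn_fourier_besselOp α h] with ξ h1 h2
  have h3 : ((sobolevWeight α ξ : ℝ) : ℂ) ≠ 0 := by exact_mod_cast (sobolevWeight_pos α ξ).ne'
  have h4 : ((fracSymbol α ξ : ℝ) : ℂ) = ((sobolevWeight α ξ : ℝ) : ℂ) ^ 2 - 1 := by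
    rw [← Complex.ofReal_pow, sobolevWeight_sq]; push_cast; ring
  rw [h1, h2, h4, RCLike.inner_apply, RCLike.inner_apply, map_mul, Complex.conj_ofReal]
  push_cast
  field_simp

end BesselPotential

/-! ### The Hilbert space model of H₀. -/

section EnergySpace

/-- The (inverse Bessel potentials of the) test functions supported in `Ω`. -/
noncomputable def testSpace (α : ℝ) (Ω : Set Plane) : Submodule ℂ L2Plane where
  carrier := {g | ∃ (φ : Plane → ℂ) (hφ : MemLp φ 2 (volume : Measure Plane)),
    ContDiff ℝ ∞ φ ∧ HasCompactSupport φ ∧ tsupport φ ⊆ Ω ∧ besselOp α g = hφ.toLp φ}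
  zero_mem' := ⟨0, MemLp.zero, contDiff_const, HasCompactSupport.zero, by simp [tsupport], by
    rw [map_zero, MemLp.toLp_zero]⟩
  add_mem' := by
    rintro g h ⟨φ, hφ, h1, h2, h3, h4⟩ ⟨ψ, hψ, k1, k2, k3, k4⟩
    refine ⟨φ + ψ, hφ.add hψ, h1.add k1, h2.add k2,
      (tsupport_add φ ψ).trans (Set.union_subset h3 k3), ?_⟩
    rw [map_add, h4, k4, MemLp.toLp_add]
  smul_mem' := by
    rintro c g ⟨φ, hφ, h1, h2, h3, h4⟩
    refine ⟨c • φ, hφ.const_smul c, h1.const_smul c, h2.smul_left (f := fun _ => c),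
      (tsupport_smul_subset_right (fun _ => c) φ).trans h3, ?_⟩
    rw [map_smul, h4, MemLp.toLp_const_smul]

/-- The Hilbert space of all `g` whose Bessel potential lies in `H₀^{α/2}(Ω)`. -/
noncomputable def energySpace (α : ℝ) (Ω : Set Plane) : Submodule ℂ L2Plane :=
  (testSpace α Ω).topologicalClosure

instance completeSpace_energySpace (α : ℝ) (Ω : Set Plane) : CompleteSpace (energySpace α Ω) :=
  (testSpace α Ω).isClosed_topologicalClosure.completeSpace_coe

/-- For 0 < α ≤ 1 the symbol is at most 1 + 2π|ξ|. One factor of the transform is bounded by its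
supremum and the other, being Schwartz, absorbs this linear growth. -/
theorem fracEnergy_toLp_schwartz_ne_top {α : ℝ} (h0 : 0 < α) (h1 : α ≤ 1)
    (f : SchwartzMap Plane ℂ) : fracEnergy α (f.toLp 2) ≠ ⊤ := by
  rw [fracEnergy, SchwartzMap.toLp_fourier_eq]
  set h := 𝓕 f with hh
  have hae : ∀ᵐ ξ : Plane, ENNReal.ofReal (fracSymbol α ξ * ‖(h.toLp 2) ξ‖ ^ 2) =
      ENNReal.ofReal (fracSymbol α ξ * ‖h ξ‖ ^ 2) := by
    filter_upwards [h.coeFn_toLp 2 volume] with ξ hξ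
    rw [hξ]
  rw [lintegral_congr_ae hae]
  obtain ⟨C, hC0, hC⟩ := h.decay 0 0
  have hC' : ∀ ξ, ‖h ξ‖ ≤ C := fun ξ => by simpa using hC ξ
  have hint : Integrable (fun ξ : Plane => C * (‖ξ‖ ^ 0 * ‖h ξ‖ + 2 * Real.pi * (‖ξ‖ ^ 1 * ‖h ξ‖))) :=
    ((h.integrable_pow_mul volume 0).add ((h.integrable_pow_mul volume 1).const_mul _)).const_mul _
  refine ((lintegral_mono fun ξ => ENNReal.ofReal_le_ofReal ?_).trans_lt
    hint.lintegral_lt_top).ne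
  have hpi := Real.pi_pos
  have hσ : fracSymbol α ξ ≤ 1 + 2 * Real.pi * ‖ξ‖ := by
    have hx : 0 ≤ 2 * Real.pi * ‖ξ‖ := by positivity
    unfold fracSymbol
    rcases le_total (2 * Real.pi * ‖ξ‖) 1 with h | h
    · linarith [Real.rpow_le_one hx h h0.le]
    · have h2 := Real.rpow_le_rpow_of_exponent_le h h1
      rw [Real.rpow_one] at h2
      linarith
  calc fracSymbol α ξ * ‖h ξ‖ ^ 2 ≤ (1 + 2 * Real.pi * ‖ξ‖) * (C * ‖h ξ‖) := by
        rw [sq]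
        have := hC' ξ
        gcongr
    _ = _ := by ring

theorem exists_schwartz_toLp_eq {φ : Plane → ℂ} (hφ : MemLp φ 2 (volume : Measure Plane))
    (h1 : ContDiff ℝ ∞ φ) (h2 : HasCompactSupport φ) :
    ∃ f : SchwartzMap Plane ℂ, f.toLp 2 = hφ.toLp φ :=
  ⟨h2.toSchwartzMap h1, rfl⟩

/-- Under the isometry `besselOp`, approximation by test functions in the Sobolev norm becomes
approximation in L², so H₀ is the image of an L² closure. -/
theorem memH0_iff {α : ℝ} (h0 : 0 < α) (h1 : α ≤ 1) (Ω : Set Plane) (u : L2Plane) :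
    MemH0 α Ω u ↔ ∃ g ∈ energySpace α Ω, besselOp α g = u := by
  have hnorm : ∀ g : L2Plane, ∀ ε : ℝ≥0∞, ENNReal.ofReal (‖besselOp α g‖ ^ 2) +
      fracEnergy α (besselOp α g) < ε ↔ ENNReal.ofReal (‖g‖ ^ 2) < ε := fun g ε => by
    rw [ofReal_norm_sq_add_fracEnergy_besselOp]
  have htest : ∀ (φ : Plane → ℂ) (hφ : MemLp φ 2 (volume : Measure Plane)),
      ContDiff ℝ ∞ φ → HasCompactSupport φ → ∃ g, besselOp α g = hφ.toLp φ := by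
    intro φ hφ k1 k2
    obtain ⟨f, hf⟩ := exists_schwartz_toLp_eq hφ k1 k2
    rw [← hf]
    exact exists_besselOp_eq_of_fracEnergy_ne_top (fracEnergy_toLp_schwartz_ne_top h0 h1 f)
  constructor
  · intro hu
    -- Any finite tolerance shows that u differs from a test function by something of finite energy,
    -- hence that u is itself a Bessel potential.
    obtain ⟨φ, hφ, k1, k2, -, hlt⟩ := hu 1 one_pos
    obtain ⟨g1, hg1⟩ := htest φ hφ k1 k2
    obtain ⟨g2, hg2⟩ := exists_besselOp_eq_of_fracEnergy_ne_top
      (ne_top_of_lt ((le_add_self).trans_lt hlt))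
    have hug : besselOp α (g2 + g1) = u := by rw [map_add, hg1, hg2, sub_add_cancel]
    refine ⟨g2 + g1, ?_, hug⟩
    rw [energySpace, ← SetLike.mem_coe, Submodule.topologicalClosure_coe, Metric.mem_closure_iff]
    intro δ hδ
    obtain ⟨ψ, hψ, j1, j2, j3, hlt2⟩ := hu (ENNReal.ofReal (δ ^ 2)) (by positivity)
    obtain ⟨g, hg⟩ := htest ψ hψ j1 j2
    refine ⟨g, ⟨ψ, hψ, j1, j2, j3, hg⟩, ?_⟩
    rw [← hug, ← hg, ← map_sub, hnorm, ENNReal.ofReal_lt_ofReal_iff (by positivity)] at hlt2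
    rw [dist_eq_norm]
    exact lt_of_pow_lt_pow_left₀ 2 hδ.le hlt2
  · rintro ⟨g, hg, rfl⟩ ε hε
    rw [energySpace, ← SetLike.mem_coe, Submodule.topologicalClosure_coe, Metric.mem_closure_iff]
      at hg
    obtain ⟨δ, hδ, hδε⟩ : ∃ δ : ℝ, 0 < δ ∧ ENNReal.ofReal (δ ^ 2) ≤ ε := by
      rcases eq_or_ne ε ⊤ with rfl | htop
      · exact ⟨1, one_pos, le_top⟩
      · refine ⟨√ε.toReal, Real.sqrt_pos.2 (ENNReal.toReal_pos hε.ne' htop), ?_⟩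
        rw [Real.sq_sqrt ENNReal.toReal_nonneg, ENNReal.ofReal_toReal htop]
    obtain ⟨g', ⟨φ, hφ, k1, k2, k3, hφg⟩, hd⟩ := hg δ hδ
    refine ⟨φ, hφ, k1, k2, k3, ?_⟩
    rw [← hφg, ← map_sub, hnorm]
    refine lt_of_lt_of_le ?_ hδε
    rw [ENNReal.ofReal_lt_ofReal_iff (by positivity), ← dist_eq_norm]
    gcongr

/-- The inclusion of `H₀^{α/2}(Ω)` into `L²`. -/
noncomputable def energyInclusion (α : ℝ) (Ω : Set Plane) : energySpace α Ω →L[ℂ] L2Plane :=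
  besselOp α ∘L (energySpace α Ω).subtypeL

theorem energyInclusion_injective (α : ℝ) (Ω : Set Plane) :
    Function.Injective (energyInclusion α Ω) :=
  (besselOp_injective α).comp Subtype.val_injective

theorem memH0_iff_exists_energyInclusion {α : ℝ} (h0 : 0 < α) (h1 : α ≤ 1) (Ω : Set Plane)
    (u : L2Plane) : MemH0 α Ω u ↔ ∃ g, energyInclusion α Ω g = u := by
  rw [memH0_iff h0 h1]
  exact ⟨fun ⟨g, hg, h⟩ => ⟨⟨g, hg⟩, h⟩, fun ⟨g, h⟩ => ⟨g, g.2, h⟩⟩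

/-- Adding the L² inner product to both sides of the weak equation completes the form to the Sobolev
inner product and shifts the eigenvalue from t to 1 + t. -/
theorem isWeakEigenfunction_iff {α : ℝ} (h0 : 0 < α) (h1 : α ≤ 1) (Ω : Set Plane) (t : ℝ)
    (u : L2Plane) : IsWeakEigenfunction α Ω t u ↔ ∃ g, energyInclusion α Ω g = u ∧
      ∀ h, inner ℂ h g =
        (1 + (t : ℂ)) * inner ℂ (energyInclusion α Ω h) (energyInclusion α Ω g) := by
  have key : ∀ g h : energySpace α Ω,
      fracForm α (energyInclusion α Ω g) (energyInclusion α Ω h) =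
        (t : ℂ) * inner ℂ (energyInclusion α Ω h) (energyInclusion α Ω g) ↔
      inner ℂ h g = (1 + (t : ℂ)) * inner ℂ (energyInclusion α Ω h) (energyInclusion α Ω g) := by
    intro g h
    have := fracForm_besselOp α g h
    change fracForm α (besselOp α g) (besselOp α h) =
        (t : ℂ) * inner ℂ (besselOp α h) (besselOp α g) ↔
      inner ℂ (h : L2Plane) (g : L2Plane) =
        (1 + (t : ℂ)) * inner ℂ (besselOp α h) (besselOp α g)
    rw [this, sub_eq_iff_eq_add]
    constructor <;> intro h <;> rw [h] <;> ring
  constructor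
  · rintro ⟨hu, hv⟩
    obtain ⟨g, rfl⟩ := (memH0_iff_exists_energyInclusion h0 h1 Ω u).1 hu
    exact ⟨g, rfl, fun h => (key g h).1
      (hv _ ((memH0_iff_exists_energyInclusion h0 h1 Ω _).2 ⟨h, rfl⟩))⟩
  · rintro ⟨g, rfl, hg⟩
    refine ⟨(memH0_iff_exists_energyInclusion h0 h1 Ω _).2 ⟨g, rfl⟩, fun v hv => ?_⟩
    obtain ⟨h, rfl⟩ := (memH0_iff_exists_energyInclusion h0 h1 Ω v).1 hv
    exact (key g h).2 (hg h)

/-- A nonempty open set contains infinitely many disjoint nonempty open pieces. Bumps in different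
pieces are orthogonal in L², hence independent. -/
theorem not_finiteDimensional_energySpace {α : ℝ} (h0 : 0 < α) (h1 : α ≤ 1) {Ω : Set Plane}
    (hΩ : IsOpen Ω) (hne : Ω.Nonempty) : ¬ FiniteDimensional ℂ (energySpace α Ω) := by
  intro hfin
  have hinf : Infinite Ω := (infinite_of_mem_nhds hne.some (hΩ.mem_nhds hne.some_mem)).to_subtype
  obtain ⟨U, hUi, hUo, hUd⟩ := exists_seq_infinite_isOpen_pairwise_disjoint Ω
  have hex : ∀ n, ∃ g : energySpace α Ω, g ≠ 0 ∧ ∃ (φ : Plane → ℂ)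
      (hφ : MemLp φ 2 (volume : Measure Plane)), tsupport φ ⊆ Subtype.val '' U n ∧
        energyInclusion α Ω g = hφ.toLp φ := by
    intro n
    obtain ⟨x, hx⟩ := (hUi n).nonempty
    have hopen : IsOpen (Subtype.val '' U n : Set Plane) := hΩ.isOpenMap_subtype_val _ (hUo n)
    obtain ⟨f, hf1, hf2, hf3, -, hf5⟩ := exists_contDiff_tsupport_subset (n := ⊤)
      (hopen.mem_nhds ⟨x, hx, rfl⟩)
    set φ : Plane → ℂ := fun y => (f y : ℂ) with hφdef
    have k1 : ContDiff ℝ ∞ φ := Complex.ofRealCLM.contDiff.comp hf3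
    have k2 : HasCompactSupport φ := hf2.comp_left (g := fun r : ℝ => (r : ℂ)) (by simp)
    have k3 : tsupport φ ⊆ Subtype.val '' U n :=
      (tsupport_comp_subset (g := fun r : ℝ => (r : ℂ)) (by simp) f).trans hf1
    have hφ : MemLp φ 2 (volume : Measure Plane) := k1.continuous.memLp_of_hasCompactSupport k2
    have hΩ' : (Subtype.val '' U n : Set Plane) ⊆ Ω := by rintro _ ⟨y, -, rfl⟩; exact y.2
    obtain ⟨s, hs⟩ := exists_schwartz_toLp_eq hφ k1 k2
    obtain ⟨g, hg⟩ := exists_besselOp_eq_of_fracEnergy_ne_top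
      (fracEnergy_toLp_schwartz_ne_top h0 h1 s)
    rw [hs] at hg
    refine ⟨⟨g, (testSpace α Ω).le_topologicalClosure ⟨φ, hφ, k1, k2, k3.trans hΩ', hg⟩⟩, ?_,
      φ, hφ, k3, hg⟩
    intro hzero
    have hg0 : g = 0 := congrArg Subtype.val hzero
    rw [hg0, map_zero] at hg
    have hae : φ =ᵐ[volume] (0 : Plane → ℂ) := by
      have := hφ.coeFn_toLp
      rw [← hg] at this
      exact this.symm.trans (Lp.coeFn_zero ℂ 2 (volume : Measure Plane))
    have := congrFun ((k1.continuous.ae_eq_iff_eq volume (continuous_const (y := (0 : ℂ)))).1 hae) x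
    simp [hφdef, hf5] at this
  choose g hg0 φ hφ hsupp hgφ using hex
  have horth : Pairwise fun i j =>
      inner ℂ (energyInclusion α Ω (g i)) (energyInclusion α Ω (g j)) = 0 := by
    intro i j hij
    rw [hgφ, hgφ, L2.inner_def]
    refine integral_eq_zero_of_ae ?_
    filter_upwards [(hφ i).coeFn_toLp, (hφ j).coeFn_toLp] with x e1 e2
    rw [e1, e2]
    have hx : φ i x = 0 ∨ φ j x = 0 := by
      by_contra! hcon
      obtain ⟨y, hy, hyx⟩ := hsupp i (subset_tsupport _ hcon.1)
      obtain ⟨z, hz, hzx⟩ := hsupp j (subset_tsupport _ hcon.2)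
      have : y = z := Subtype.ext (hyx.trans hzx.symm)
      exact Set.disjoint_left.1 (hUd hij) hy (this ▸ hz)
    rcases hx with hx | hx <;> simp [hx]
  have hli := linearIndependent_of_ne_zero_of_inner_eq_zero (𝕜 := ℂ)
    (v := fun n => energyInclusion α Ω (g n))
    (fun n h => hg0 n (energyInclusion_injective α Ω (by rw [h, map_zero]))) horth
  have hli' : LinearIndependent ℂ g :=
    LinearIndependent.of_comp (energyInclusion α Ω : energySpace α Ω →ₗ[ℂ] L2Plane) hli
  exact not_finite_iff_infinite.2 inferInstance hli'.finite_of_isNoetherian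

end EnergySpace

/-! ### Operators with square-integrable kernels. -/

section KernelOperators

variable {H X : Type*} [NormedAddCommGroup H] [NormedSpace ℂ H] [MeasurableSpace X]
  {μ : Measure X}

/-- The operator `g ↦ (x ↦ k x g)` with a square-integrable kernel `k` of functionals. -/
noncomputable def kernelOp : Lp (H →L[ℂ] ℂ) 2 μ →L[ℂ] H →L[ℂ] Lp ℂ 2 μ :=
  LinearMap.mkContinuous₂
    (LinearMap.mk₂ ℂ (fun (k : Lp (H →L[ℂ] ℂ) 2 μ) (g : H) =>
        (ContinuousLinearMap.apply ℂ ℂ g).compLp k)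
      (fun k k' g => ((ContinuousLinearMap.apply ℂ ℂ g).compLpₗ 2 μ).map_add k k')
      (fun c k g => ((ContinuousLinearMap.apply ℂ ℂ g).compLpₗ 2 μ).map_smul c k)
      (fun k g g' => by
        rw [map_add, ContinuousLinearMap.add_compLp])
      (fun c k g => by
        rw [map_smul, ContinuousLinearMap.smul_compLp]))
    1 (fun k g => by
      change ‖(ContinuousLinearMap.apply ℂ ℂ g).compLp k‖ ≤ _
      rw [one_mul, mul_comm]
      refine (ContinuousLinearMap.norm_compLp_le _ _).trans ?_
      gcongr
      exact ContinuousLinearMap.opNorm_le_bound _ (norm_nonneg _) fun f => by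
        rw [ContinuousLinearMap.apply_apply, mul_comm]
        exact f.le_opNorm g)

theorem coeFn_kernelOp (k : Lp (H →L[ℂ] ℂ) 2 μ) (g : H) :
    kernelOp k g =ᵐ[μ] fun x => k x g :=
  (ContinuousLinearMap.apply ℂ ℂ g).coeFn_compLp' k

/-- Operators with a square-integrable kernel are compact. -/
theorem isCompactOperator_kernelOp (k : Lp (H →L[ℂ] ℂ) 2 μ) : IsCompactOperator (kernelOp k) := by
  -- An indicator kernel gives an operator of rank at most one; sums and norm limits then reach
  -- every kernel, since compact operators form a closed set.
  refine Lp.induction ENNReal.ofNat_ne_top (fun k => IsCompactOperator (kernelOp k)) ?_ ?_ ?_ k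
  · intro c s hs hμs
    rw [Lp.simpleFunc.coe_indicatorConst]
    have h : kernelOp (indicatorConstLp 2 hs hμs.ne c) =
        (ContinuousLinearMap.toSpanSingleton ℂ (indicatorConstLp 2 hs hμs.ne (1 : ℂ))) ∘L c := by
      ext1 g
      apply Lp.ext
      rw [ContinuousLinearMap.comp_apply, ContinuousLinearMap.toSpanSingleton_apply]
      filter_upwards [coeFn_kernelOp (indicatorConstLp 2 hs hμs.ne c) g,
        indicatorConstLp_coeFn (p := 2) (hs := hs) (hμs := hμs.ne) (c := c),
        indicatorConstLp_coeFn (p := 2) (hs := hs) (hμs := hμs.ne) (c := (1 : ℂ)),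
        Lp.coeFn_smul (c g) (indicatorConstLp 2 hs hμs.ne (1 : ℂ))] with x h1 h2 h3 h4
      rw [h1, h2, h4, Pi.smul_apply, h3]
      by_cases hx : x ∈ s <;> simp [hx]
    rw [h]
    have hcomp : IsCompactOperator c := isCompactOperator_of_locallyCompactSpace_dom c
    exact hcomp.clm_comp (ContinuousLinearMap.toSpanSingleton ℂ (indicatorConstLp 2 hs hμs.ne (1 : ℂ)))
  · intro f g hf hg _ h1 h2
    rw [map_add]
    exact h1.add h2
  · exact isClosed_setOfPred_isCompactOperator.preimage (kernelOp (H := H) (μ := μ)).continuous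

end KernelOperators

/-! ### Compactness of the inclusion of H₀ into L². -/

section Compactness

/-- Multiplication by the indicator function of a ball centred at `0`. -/
noncomputable def cutoffOp (ρ : ℝ) : L2Plane →L[ℂ] L2Plane :=
  mulOp ((Metric.closedBall 0 ρ).indicator 1)
    (measurable_one.indicator Metric.isClosed_closedBall.measurableSet) 1 fun x => by
      by_cases hx : x ∈ Metric.closedBall (0 : Plane) ρ <;> simp [Set.indicator, hx]

theorem memLp_of_continuous_compact {f : Plane → ℂ} (hf : Continuous f) (hc : HasCompactSupport f) :
    MemLp f 2 (volume : Measure Plane) :=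
  hf.memLp_of_hasCompactSupport hc

theorem coeFn_cutoffOp (ρ : ℝ) (u : L2Plane) : cutoffOp ρ u =ᵐ[volume]
    fun x => (Metric.closedBall (0 : Plane) ρ).indicator 1 x * u x :=
  coeFn_mulOp _ _ _ _ _

theorem clm_ext_schwartz {S T : L2Plane →L[ℂ] L2Plane}
    (h : ∀ f : SchwartzMap Plane ℂ, S (f.toLp 2) = T (f.toLp 2)) : S = T := by
  have hd := SchwartzMap.denseRange_toLpCLM (E := Plane) (F := ℂ) (p := 2)
    (μ := (volume : Measure Plane)) ENNReal.ofNat_ne_top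
  exact DFunLike.coe_injective (hd.equalizer S.continuous T.continuous (funext h))

theorem norm_exp_neg_mul_I_sub_le (a b : ℝ) :
    ‖Complex.exp (-(a : ℝ) * Complex.I) - Complex.exp (-(b : ℝ) * Complex.I)‖ ≤ |a - b| := by
  have h1 : Complex.exp (-(a : ℝ) * Complex.I) - Complex.exp (-(b : ℝ) * Complex.I) =
      Complex.exp (((-b : ℝ) : ℂ) * Complex.I) *
        (Complex.exp (Complex.I * ((b - a : ℝ) : ℂ)) - 1) := by
    rw [mul_sub, ← Complex.exp_add]
    push_cast
    congr 2 <;> ring_nf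
  rw [h1, norm_mul, Complex.norm_exp_ofReal_mul_I, one_mul]
  refine Real.norm_exp_I_mul_ofReal_sub_one_le.trans ?_
  rw [Real.norm_eq_abs, abs_sub_comm]

/-- The function representing `g ↦ (𝓕⁻¹ (χ g)) x` on `L²`. -/
noncomputable def bandKernel (χ : Plane → ℂ) (x ξ : Plane) : ℂ :=
  Complex.exp (-(2 * Real.pi * inner ℝ ξ x : ℝ) * Complex.I) * (starRingEnd ℂ) (χ ξ)

theorem memLp_bandKernel {χ : Plane → ℂ} (hχ : Continuous χ) (hc : HasCompactSupport χ)
    (x : Plane) : MemLp (bandKernel χ x) 2 (volume : Measure Plane) := by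
  refine memLp_of_continuous_compact (by unfold bandKernel; fun_prop) ?_
  have : HasCompactSupport (fun ξ => (starRingEnd ℂ) (χ ξ)) :=
    hc.comp_left (g := starRingEnd ℂ) (map_zero _)
  exact this.mul_left

/-- The characters at x and y differ by at most 2π|ξ||x − y|, so the kernel is Lipschitz in x with
constant 2π times the L² norm of |ξ|χ(ξ). -/
theorem continuous_toLp_bandKernel {χ : Plane → ℂ} (hχ : Continuous χ)
    (hc : HasCompactSupport χ) : Continuous fun x => (memLp_bandKernel hχ hc x).toLp := by
  have hψ : MemLp (fun ξ : Plane => (‖ξ‖ : ℂ) * χ ξ) 2 (volume : Measure Plane) :=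
    memLp_of_continuous_compact (by fun_prop) hc.mul_left
  refine (LipschitzWith.of_dist_le_mul (K := ⟨2 * Real.pi * ‖hψ.toLp‖, by positivity⟩)
    fun x y => ?_).continuous
  rw [dist_eq_norm, dist_eq_norm]
  change _ ≤ 2 * Real.pi * ‖hψ.toLp‖ * ‖x - y‖
  rw [← MemLp.toLp_sub,
    show 2 * Real.pi * ‖hψ.toLp‖ * ‖x - y‖ = 2 * Real.pi * ‖x - y‖ * ‖hψ.toLp‖ by ring]
  refine Lp.norm_le_mul_norm_of_ae_le_mul ?_
  filter_upwards [((memLp_bandKernel hχ hc x).sub (memLp_bandKernel hχ hc y)).coeFn_toLp,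
    hψ.coeFn_toLp] with ξ h1 h2
  rw [h1, h2, Pi.sub_apply, bandKernel, bandKernel, ← sub_mul, norm_mul, norm_mul,
    RCLike.norm_conj, ← mul_assoc, Complex.norm_real, norm_norm]
  refine mul_le_mul_of_nonneg_right ((norm_exp_neg_mul_I_sub_le _ _).trans ?_) (norm_nonneg _)
  rw [← mul_sub, ← inner_sub_right, abs_mul, abs_of_pos Real.two_pi_pos]
  have := abs_real_inner_le_norm ξ (x - y)
  have hpi := Real.two_pi_pos
  rw [mul_assoc (2 * Real.pi), mul_comm ‖x - y‖]
  gcongr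

/-- For Schwartz f the product χf is Schwartz, so the pointwise Fourier inversion integral applies
and is an inner product against the kernel. Density extends the resulting operator identity later.
-/
theorem fourierInv_bump_schwartz {χ : Plane → ℂ} (hχ : ContDiff ℝ ∞ χ) (hc : HasCompactSupport χ)
    (hb : ∀ ξ, ‖χ ξ‖ ≤ 1) (f : SchwartzMap Plane ℂ) :
    fourierL2.symm (mulOp χ hχ.continuous.measurable 1 hb (f.toLp 2)) =ᵐ[volume]
      fun x => inner ℂ (memLp_bandKernel hχ.continuous hc x).toLp (f.toLp 2) := by
  have hs1 : ContDiff ℝ ∞ (fun ξ => χ ξ * f ξ) := hχ.mul (f.smooth ⊤)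
  have hs2 : HasCompactSupport (fun ξ => χ ξ * f ξ) := hc.mul_right
  obtain ⟨s, hs⟩ : ∃ s : SchwartzMap Plane ℂ, ∀ ξ, s ξ = χ ξ * f ξ :=
    ⟨hs2.toSchwartzMap hs1, fun _ => rfl⟩
  have h1 : mulOp χ hχ.continuous.measurable 1 hb (f.toLp 2) = s.toLp 2 := by
    apply Lp.ext
    filter_upwards [coeFn_mulOp χ hχ.continuous.measurable 1 hb (f.toLp 2),
      f.coeFn_toLp 2 volume, s.coeFn_toLp 2 volume] with ξ e1 e2 e3
    rw [e1, e2, e3, hs]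
  have h2 : fourierL2.symm (s.toLp 2) = (𝓕⁻ s).toLp 2 := SchwartzMap.toLp_fourierInv_eq s
  rw [h1, h2]
  filter_upwards [(𝓕⁻ s).coeFn_toLp 2 volume] with x e2
  rw [e2, L2.inner_def, SchwartzMap.fourierInv_coe, Real.fourierInv_eq']
  refine integral_congr_ae ?_
  filter_upwards [(memLp_bandKernel hχ.continuous hc x).coeFn_toLp, f.coeFn_toLp 2 volume]
    with ξ j1 j2
  rw [j1, j2, hs, RCLike.inner_apply, bandKernel, map_mul, Complex.conj_conj, ← Complex.exp_conj,
    smul_eq_mul, map_mul, map_neg, Complex.conj_ofReal, Complex.conj_I]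
  push_cast
  ring_nf

/-- The kernel depends continuously on x, so it is bounded on the ball; the cutoff removes
everything outside a set of finite measure. -/
theorem exists_memLp_cutoff_bandKernel (ρ : ℝ) {χ : Plane → ℂ} (hχ : Continuous χ)
    (hc : HasCompactSupport χ) :
    ∃ (k : Plane → L2Plane →L[ℂ] ℂ) (_ : MemLp k 2 (volume : Measure Plane)), ∀ x g,
      k x g = (Metric.closedBall (0 : Plane) ρ).indicator 1 x *
        inner ℂ (memLp_bandKernel hχ hc x).toLp g := by
  have hX : MeasurableSet (Metric.closedBall (0 : Plane) ρ) :=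
    Metric.isClosed_closedBall.measurableSet
  have hκ := continuous_toLp_bandKernel hχ hc
  set κ : Plane → L2Plane := fun x => (memLp_bandKernel hχ hc x).toLp
  have hcont : Continuous fun x => innerSL ℂ (κ x) := (innerSL ℂ).continuous.comp hκ
  obtain ⟨C, hC⟩ := (isCompact_closedBall (0 : Plane) ρ).exists_bound_of_continuousOn
    hcont.continuousOn
  have hind : MemLp ((Metric.closedBall (0 : Plane) ρ).indicator fun _ => C) 2
      (volume : Measure Plane) :=
    memLp_indicator_const 2 hX C (Or.inr measure_closedBall_lt_top.ne)
  refine ⟨fun x => ((Metric.closedBall (0 : Plane) ρ).indicator (1 : Plane → ℂ) x) • innerSL ℂ (κ x),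
    hind.mono ?_ (Filter.Eventually.of_forall fun x => ?_), fun x g => rfl⟩
  · have h1 : Measurable ((Metric.closedBall (0 : Plane) ρ).indicator (1 : Plane → ℂ)) :=
      measurable_one.indicator hX
    exact h1.aestronglyMeasurable.smul hcont.aestronglyMeasurable
  · by_cases hx : x ∈ Metric.closedBall (0 : Plane) ρ
    · rw [Set.indicator_of_mem hx, Set.indicator_of_mem hx, Pi.one_apply, one_smul]
      exact (hC x hx).trans (le_abs_self C)
    · rw [Set.indicator_of_notMem hx, Set.indicator_of_notMem hx, norm_smul, norm_zero, zero_mul,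
        norm_zero]

/-- Band limitation by a bump function followed by restriction to a ball is compact. -/
theorem isCompactOperator_cutoff_fourierInv_bump (ρ : ℝ) {χ : Plane → ℂ} (hχ : ContDiff ℝ ∞ χ)
    (hc : HasCompactSupport χ) (hb : ∀ ξ, ‖χ ξ‖ ≤ 1) :
    IsCompactOperator (cutoffOp ρ ∘L (fourierL2.symm.toContinuousLinearEquiv : L2Plane →L[ℂ] L2Plane)
      ∘L mulOp χ hχ.continuous.measurable 1 hb) := by
  obtain ⟨k, hk, hkval⟩ := exists_memLp_cutoff_bandKernel ρ hχ.continuous hc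
  have heq : cutoffOp ρ ∘L (fourierL2.symm.toContinuousLinearEquiv : L2Plane →L[ℂ] L2Plane)
      ∘L mulOp χ hχ.continuous.measurable 1 hb = kernelOp (hk.toLp) := by
    refine clm_ext_schwartz fun f => ?_
    rw [ContinuousLinearMap.comp_apply, ContinuousLinearMap.comp_apply]
    have e2 := fourierInv_bump_schwartz hχ hc hb f
    have e3 := coeFn_kernelOp hk.toLp (f.toLp 2)
    have hval : ∀ v, (fourierL2.symm.toContinuousLinearEquiv : L2Plane →L[ℂ] L2Plane) v =
      fourierL2.symm v := fun _ => rfl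
    rw [hval]
    generalize fourierL2.symm (mulOp χ hχ.continuous.measurable 1 hb (f.toLp 2)) = u at e2 ⊢
    have e1 := coeFn_cutoffOp ρ u
    have e4 := hk.coeFn_toLp
    apply Lp.ext
    filter_upwards [e1, e2, e3, e4] with x e1 e2 e3 e4
    rw [e1, e2, e3, e4, hkval]
  rw [heq]
  exact isCompactOperator_kernelOp _

theorem norm_cutoffOp_le (ρ : ℝ) : ‖cutoffOp ρ‖ ≤ 1 := norm_mulOp_le _ _ _ _

theorem exists_inv_sobolevWeight_le {α : ℝ} (h0 : 0 < α) {ε : ℝ} (hε : 0 < ε) :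
    ∃ R : ℝ, 0 < R ∧ ∀ ξ : Plane, R ≤ ‖ξ‖ → (sobolevWeight α ξ)⁻¹ ≤ ε := by
  have hlim := (tendsto_rpow_atTop h0).eventually_ge_atTop ((ε⁻¹) ^ 2)
  obtain ⟨R, hR⟩ := Filter.eventually_atTop.1 hlim
  refine ⟨max R 1, by positivity, fun ξ hξ => ?_⟩
  rw [inv_le_comm₀ (sobolevWeight_pos α ξ) hε]
  refine Real.le_sqrt_of_sq_le ?_
  have hpi := Real.pi_gt_three
  have h1 : ‖ξ‖ ≤ 2 * Real.pi * ‖ξ‖ := by nlinarith [norm_nonneg ξ]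
  have := hR (2 * Real.pi * ‖ξ‖) (((le_max_left _ _).trans hξ).trans h1)
  unfold fracSymbol
  linarith

/-- The weight tends to infinity, so discarding high frequencies changes the operator by little in
norm. What remains is band-limited and has a square-integrable kernel. -/
theorem isCompactOperator_cutoff_besselOp {α : ℝ} (h0 : 0 < α) (ρ : ℝ) :
    IsCompactOperator (cutoffOp ρ ∘L besselOp α) := by
  change cutoffOp ρ ∘L besselOp α ∈ {T : L2Plane →L[ℂ] L2Plane | IsCompactOperator T}
  rw [← (isClosed_setOfPred_isCompactOperator (M₁ := L2Plane) (M₂ := L2Plane)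
    (σ₁₂ := RingHom.id ℂ)).closure_eq, Metric.mem_closure_iff]
  intro ε hε
  obtain ⟨R, hR0, hR⟩ := exists_inv_sobolevWeight_le h0 (half_pos hε)
  -- The bump equals 1 on the ball of radius R, so 1 − χ vanishes where the inverse weight may still
  -- exceed ε / 2.
  let b : ContDiffBump (0 : Plane) := ⟨R, R + 1, hR0, by linarith⟩
  let χ : Plane → ℂ := fun ξ => (b ξ : ℂ)
  have hχ : ContDiff ℝ ∞ χ := Complex.ofRealCLM.contDiff.comp b.contDiff
  have hc : HasCompactSupport χ := b.hasCompactSupport.comp_left (g := fun r : ℝ => (r : ℂ)) (by simp)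
  have hb : ∀ ξ, ‖χ ξ‖ ≤ 1 := fun ξ => by
    rw [Complex.norm_real, Real.norm_of_nonneg b.nonneg]
    exact b.le_one
  have htail : ∀ ξ, ‖(1 - χ ξ) * (((sobolevWeight α ξ)⁻¹ : ℝ) : ℂ)‖ ≤ ε / 2 := by
    intro ξ
    have h1 : (1 - χ ξ) = ((1 - b ξ : ℝ) : ℂ) := by push_cast; rfl
    rw [h1, norm_mul, Complex.norm_real, Complex.norm_real,
      Real.norm_of_nonneg (sub_nonneg.2 b.le_one),
      Real.norm_of_nonneg (inv_nonneg.2 (sobolevWeight_pos α ξ).le)]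
    rcases le_total ‖ξ‖ R with h | h
    · rw [b.one_of_mem_closedBall (by simpa using h)]
      simpa using (half_pos hε).le
    · have h2 := hR ξ h
      have h3 := sobolevWeight_pos α ξ
      have h4 : 1 - b ξ ≤ 1 := by linarith [b.nonneg (x := ξ)]
      calc _ ≤ 1 * (ε / 2) := by gcongr
        _ = ε / 2 := one_mul _
  have hmt : Measurable fun ξ => (1 - χ ξ) * (((sobolevWeight α ξ)⁻¹ : ℝ) : ℂ) :=
    (measurable_const.sub hχ.continuous.measurable).mul (measurable_inv_sobolevWeight α)
  set W := mulOp _ (measurable_inv_sobolevWeight α) 1 (norm_inv_sobolevWeight_le α) with hW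
  set M := mulOp χ hχ.continuous.measurable 1 hb with hM
  set Tl := mulOp _ hmt (ε / 2) htail with hTl
  have hsplit : W = M ∘L W + Tl := by
    ext1 g
    apply Lp.ext
    rw [add_apply, ContinuousLinearMap.comp_apply]
    filter_upwards [coeFn_mulOp _ (measurable_inv_sobolevWeight α) 1 (norm_inv_sobolevWeight_le α) g,
      coeFn_mulOp χ hχ.continuous.measurable 1 hb (W g), coeFn_mulOp _ hmt (ε / 2) htail g,
      Lp.coeFn_add (M (W g)) (Tl g)] with ξ e1 e2 e3 e4
    rw [e4, Pi.add_apply, e2, e3, e1]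
    ring
  set Fi : L2Plane →L[ℂ] L2Plane :=
    (fourierL2.symm.toContinuousLinearEquiv : L2Plane →L[ℂ] L2Plane) with hFi
  refine ⟨(cutoffOp ρ ∘L Fi ∘L M) ∘L W,
    (isCompactOperator_cutoff_fourierInv_bump ρ hχ hc hb).comp_clm W, ?_⟩
  have hdiff : cutoffOp ρ ∘L besselOp α - (cutoffOp ρ ∘L Fi ∘L M) ∘L W =
      cutoffOp ρ ∘L Fi ∘L Tl := by
    ext1 g
    have := DFunLike.congr_fun hsplit g
    change cutoffOp ρ (Fi (W g)) - cutoffOp ρ (Fi (M (W g))) = cutoffOp ρ (Fi (Tl g))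
    rw [← map_sub, ← map_sub]
    congr 2
    rw [sub_eq_iff_eq_add, add_comm]
    exact this
  rw [dist_eq_norm, hdiff]
  refine lt_of_le_of_lt (ContinuousLinearMap.opNorm_le_bound _ (half_pos hε).le fun g => ?_)
    (half_lt_self hε)
  calc ‖cutoffOp ρ (Fi (Tl g))‖ ≤ 1 * ‖Fi (Tl g)‖ :=
        (cutoffOp ρ).le_of_opNorm_le (norm_cutoffOp_le ρ) _
    _ = ‖Tl g‖ := by rw [one_mul]; exact fourierL2.symm.norm_map _
    _ ≤ ε / 2 * ‖g‖ := Tl.le_of_opNorm_le (norm_mulOp_le _ _ _ _) _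

/-- Cutting off to a ball containing Ω fixes test functions, hence their closure, so the inclusion
factors through the compact cut-off Bessel potential. -/
theorem isCompactOperator_energyInclusion {α : ℝ} (h0 : 0 < α) {Ω : Set Plane}
    (hΩ : Bornology.IsBounded Ω) : IsCompactOperator (energyInclusion α Ω) := by
  obtain ⟨ρ, hρ⟩ := hΩ.subset_closedBall 0
  have hfix : ∀ g ∈ energySpace α Ω, cutoffOp ρ (besselOp α g) = besselOp α g := by
    intro g hg
    have hclosed : IsClosed {g | cutoffOp ρ (besselOp α g) = besselOp α g} :=
      isClosed_eq ((cutoffOp ρ).continuous.comp (besselOp α).continuous) (besselOp α).continuous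
    refine closure_minimal (s := (testSpace α Ω : Set L2Plane)) ?_ hclosed hg
    rintro g ⟨φ, hφ, -, -, hs, hg⟩
    change cutoffOp ρ (besselOp α g) = besselOp α g
    rw [hg]
    apply Lp.ext
    filter_upwards [coeFn_cutoffOp ρ hφ.toLp, hφ.coeFn_toLp] with x e1 e2
    rw [e1, e2]
    by_cases hx : x ∈ Metric.closedBall (0 : Plane) ρ
    · rw [Set.indicator_of_mem hx, Pi.one_apply, one_mul]
    · have : φ x = 0 := by
        by_contra hne
        exact hx (hρ (hs (subset_tsupport _ hne)))
      rw [this, mul_zero]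
  have heq : energyInclusion α Ω = (cutoffOp ρ ∘L besselOp α) ∘L (energySpace α Ω).subtypeL := by
    ext1 g
    exact (hfix g g.2).symm
  rw [heq]
  exact (isCompactOperator_cutoff_besselOp h0 ρ).comp_clm _

end Compactness

/-! ### The Dirichlet spectrum and its variational bound. -/

section Spectrum

theorem norm_besselOp_sq_le (α : ℝ) (g : L2Plane) : ‖besselOp α g‖ ^ 2 ≤ ‖g‖ ^ 2 := by
  have h := ofReal_norm_sq_add_fracEnergy_besselOp α g
  have h1 : ENNReal.ofReal (‖besselOp α g‖ ^ 2) ≤ ENNReal.ofReal (‖g‖ ^ 2) := h ▸ le_self_add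
  exact (ENNReal.ofReal_le_ofReal_iff (by positivity)).1 h1

theorem fracEnergy_besselOp (α : ℝ) (g : L2Plane) :
    fracEnergy α (besselOp α g) = ENNReal.ofReal (‖g‖ ^ 2 - ‖besselOp α g‖ ^ 2) := by
  rw [ENNReal.ofReal_sub _ (by positivity), ← ofReal_norm_sq_add_fracEnergy_besselOp,
    ENNReal.add_sub_cancel_left ENNReal.ofReal_ne_top]

/-- The Dirichlet spectrum of the fractional Laplacian on a bounded open set: the eigenvalue levels
are the half-lines `[s k, ∞)`, the numbers `s k` are energies of orthonormal functions, and their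
partial sums bound from below the total energy of any orthonormal family. -/
theorem exists_spectrum {α : ℝ} (h0 : 0 < α) (h1 : α ≤ 1) {Ω : Set Plane} (hΩ : IsOpen Ω)
    (hb : Bornology.IsBounded Ω) (hne : Ω.Nonempty) :
    ∃ s : ℕ → ℝ, (∀ k, 0 ≤ s k) ∧ (∀ k, eigenvalueLevels α Ω (k + 1) = Set.Ici (s k)) ∧
      (∃ u : ℕ → L2Plane, Orthonormal ℂ u ∧
        ∀ k, MemH0 α Ω (u k) ∧ fracEnergy α (u k) = ENNReal.ofReal (s k)) ∧
      ∀ (n : ℕ) (v : Fin n → L2Plane), Orthonormal ℂ v → (∀ j, MemH0 α Ω (v j)) →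
        ENNReal.ofReal (∑ k ∈ Finset.range n, s k) ≤ ∑ j, fracEnergy α (v j) := by
  obtain ⟨e, m, hm, hanti, he, hJ, hmax⟩ := exists_singularSystem (energyInclusion α Ω)
    (isCompactOperator_energyInclusion h0 hb) (energyInclusion_injective α Ω)
    (not_finiteDimensional_energySpace h0 h1 hΩ hne)
  have hu := orthonormal_smul_singular hm he hJ
  have hunorm : ∀ k, ‖((((m k : ℝ) : ℂ)⁻¹ • e k : energySpace α Ω) : L2Plane)‖ ^ 2 =
      1 / m k ^ 2 := by
    intro k
    rw [← Submodule.coe_norm, norm_smul, he.1 k, norm_inv, Complex.norm_real,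
      Real.norm_of_nonneg (hm k).le, mul_one, one_div, inv_pow]
  have hunorm' : ∀ k, ‖besselOp α ((((m k : ℝ) : ℂ)⁻¹ • e k : energySpace α Ω) : L2Plane)‖ = 1 :=
    fun k => hu.1 k
  -- The subtracted 1 removes the L² part of the Sobolev norm of a normalised eigenfunction.
  refine ⟨fun k => 1 / m k ^ 2 - 1, fun k => ?_, fun k => ?_, ⟨_, hu, fun k => ⟨?_, ?_⟩⟩, ?_⟩
  · have := norm_besselOp_sq_le α ((((m k : ℝ) : ℂ)⁻¹ • e k : energySpace α Ω) : L2Plane)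
    rw [hunorm, hunorm'] at this
    linarith
  · ext t
    rw [Set.mem_Ici, ← lt_rank_span_eigenvectors_iff hm hanti he hJ hmax k t]
    have hset : {u | ∃ s ≤ t, IsWeakEigenfunction α Ω s u} = {u | ∃ s ≤ t, ∃ g,
        energyInclusion α Ω g = u ∧ ∀ h, inner ℂ h g =
          (1 + (s : ℂ)) * inner ℂ (energyInclusion α Ω h) (energyInclusion α Ω g)} :=
      Set.ext fun u => exists_congr fun s => and_congr_right fun _ =>
        isWeakEigenfunction_iff h0 h1 Ω s u
    rw [← hset]
    rfl
  · exact (memH0_iff_exists_energyInclusion h0 h1 Ω _).2 ⟨_, rfl⟩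
  · change fracEnergy α (besselOp α ((((m k : ℝ) : ℂ)⁻¹ • e k : energySpace α Ω) : L2Plane)) = _
    rw [fracEnergy_besselOp, hunorm, hunorm', one_pow]
  · intro n v hv hmem
    choose g hg using fun j => (memH0_iff_exists_energyInclusion h0 h1 Ω (v j)).1 (hmem j)
    have hvg : v = fun j => energyInclusion α Ω (g j) := funext fun j => (hg j).symm
    rw [hvg] at hv
    have hsum := sum_inv_sq_le_sum_norm_sq hm hanti he hJ hmax n g hv
    have henergy : ∀ j, fracEnergy α (v j) = ENNReal.ofReal (‖g j‖ ^ 2 - 1) := by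
      intro j
      have h2 : ‖besselOp α (g j)‖ = 1 := hv.1 j
      rw [← hg]
      change fracEnergy α (besselOp α (g j)) = _
      rw [fracEnergy_besselOp, h2, one_pow, ← Submodule.coe_norm]
    simp_rw [henergy]
    rw [← ENNReal.ofReal_sum_of_nonneg]
    · refine ENNReal.ofReal_le_ofReal ?_
      simp only [Finset.sum_sub_distrib, Finset.sum_const, Finset.card_range, Finset.card_univ,
        Fintype.card_fin]
      linarith
    · intro j _
      have h2 : ‖besselOp α (g j)‖ = 1 := hv.1 j
      have := norm_besselOp_sq_le α (g j)
      rw [h2, ← Submodule.coe_norm] at this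
      linarith

end Spectrum

/-! ### Composition with maps that scale Lebesgue measure. -/

section Composition

variable {f : Plane → Plane} {c : ℝ}

theorem quasiMeasurePreserving_of_map_eq (hf : Measurable f)
    (hmap : Measure.map f (volume : Measure Plane) = ENNReal.ofReal c • volume) :
    Measure.QuasiMeasurePreserving f (volume : Measure Plane) volume :=
  ⟨hf, by rw [hmap]; exact Measure.smul_absolutelyContinuous⟩

theorem memLp_comp_of_map_eq (hf : Measurable f)
    (hmap : Measure.map f (volume : Measure Plane) = ENNReal.ofReal c • volume) (u : L2Plane) :
    MemLp (fun x => u (f x)) 2 (volume : Measure Plane) := by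
  refine MemLp.comp_of_map (f := f) (g := u) ?_ hf.aemeasurable
  rw [hmap]
  exact (Lp.memLp u).smul_measure ENNReal.ofReal_ne_top

theorem inner_toLp_comp (hf : Measurable f) (hc : 0 < c)
    (hmap : Measure.map f (volume : Measure Plane) = ENNReal.ofReal c • volume) (u v : L2Plane) :
    inner ℂ (memLp_comp_of_map_eq hf hmap u).toLp (memLp_comp_of_map_eq hf hmap v).toLp =
      (c : ℂ) * inner ℂ u v := by
  rw [L2.inner_def, L2.inner_def]
  have h1 : ∫ x, inner ℂ (u (f x)) (v (f x)) =
      ∫ y, inner ℂ (u y) (v y) ∂(Measure.map f (volume : Measure Plane)) := by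
    rw [integral_map hf.aemeasurable]
    rw [hmap]
    exact ((Lp.aestronglyMeasurable u).inner (Lp.aestronglyMeasurable v)).smul_measure _
  rw [hmap, integral_smul_measure, ENNReal.toReal_ofReal hc.le] at h1
  rw [← Complex.real_smul, ← h1]
  refine integral_congr_ae ?_
  filter_upwards [(memLp_comp_of_map_eq hf hmap u).coeFn_toLp,
    (memLp_comp_of_map_eq hf hmap v).coeFn_toLp] with x e1 e2
  rw [e1, e2]

theorem norm_toLp_comp (hf : Measurable f) (hc : 0 < c)
    (hmap : Measure.map f (volume : Measure Plane) = ENNReal.ofReal c • volume) (u : L2Plane) :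
    ‖(memLp_comp_of_map_eq hf hmap u).toLp‖ = √c * ‖u‖ := by
  have h := inner_toLp_comp hf hc hmap u u
  rw [inner_self_eq_norm_sq_to_K, inner_self_eq_norm_sq_to_K] at h
  have h1 : ((‖(memLp_comp_of_map_eq hf hmap u).toLp‖ ^ 2 : ℝ) : ℂ) =
      ((c * ‖u‖ ^ 2 : ℝ) : ℂ) := by
    push_cast; exact h
  have h2 := Complex.ofReal_injective h1
  rw [← Real.sqrt_sq (norm_nonneg (memLp_comp_of_map_eq hf hmap u).toLp), h2,
    Real.sqrt_mul hc.le, Real.sqrt_sq (norm_nonneg _)]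

/-- Composition with a map of the plane that multiplies the measure by `c`, on `L²`. -/
noncomputable def compOp (hf : Measurable f) (hc : 0 < c)
    (hmap : Measure.map f (volume : Measure Plane) = ENNReal.ofReal c • volume) :
    L2Plane →L[ℂ] L2Plane :=
  LinearMap.mkContinuous
    { toFun := fun u => (memLp_comp_of_map_eq hf hmap u).toLp
      map_add' := fun u v => by
        apply Lp.ext
        filter_upwards [(memLp_comp_of_map_eq hf hmap (u + v)).coeFn_toLp,
          (memLp_comp_of_map_eq hf hmap u).coeFn_toLp, (memLp_comp_of_map_eq hf hmap v).coeFn_toLp,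
          (quasiMeasurePreserving_of_map_eq hf hmap).ae_eq_comp (Lp.coeFn_add u v),
          Lp.coeFn_add (memLp_comp_of_map_eq hf hmap u).toLp (memLp_comp_of_map_eq hf hmap v).toLp]
          with x h1 h2 h3 h4 h5
        rw [h1, h5, Pi.add_apply, h2, h3]
        exact h4
      map_smul' := fun a u => by
        apply Lp.ext
        filter_upwards [(memLp_comp_of_map_eq hf hmap (a • u)).coeFn_toLp,
          (memLp_comp_of_map_eq hf hmap u).coeFn_toLp,
          (quasiMeasurePreserving_of_map_eq hf hmap).ae_eq_comp (Lp.coeFn_smul a u),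
          Lp.coeFn_smul a (memLp_comp_of_map_eq hf hmap u).toLp] with x h1 h2 h3 h4
        rw [h1, RingHom.id_apply, h4, Pi.smul_apply, h2]
        exact h3 }
    (√c) fun u => (norm_toLp_comp hf hc hmap u).le

theorem coeFn_compOp (hf : Measurable f) (hc : 0 < c)
    (hmap : Measure.map f (volume : Measure Plane) = ENNReal.ofReal c • volume) (u : L2Plane) :
    compOp hf hc hmap u =ᵐ[volume] fun x => u (f x) :=
  (memLp_comp_of_map_eq hf hmap u).coeFn_toLp

theorem inner_compOp (hf : Measurable f) (hc : 0 < c)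
    (hmap : Measure.map f (volume : Measure Plane) = ENNReal.ofReal c • volume) (u v : L2Plane) :
    inner ℂ (compOp hf hc hmap u) (compOp hf hc hmap v) = (c : ℂ) * inner ℂ u v :=
  inner_toLp_comp hf hc hmap u v

theorem norm_compOp (hf : Measurable f) (hc : 0 < c)
    (hmap : Measure.map f (volume : Measure Plane) = ENNReal.ofReal c • volume) (u : L2Plane) :
    ‖compOp hf hc hmap u‖ = √c * ‖u‖ :=
  norm_toLp_comp hf hc hmap u

end Composition

/-! ### Affine maps and the Fourier transform. -/

section AffineMaps

/-- The factor by which an affine map with linear part `A` multiplies the measure. -/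
noncomputable def detFactor (A : Plane ≃L[ℝ] Plane) : ℝ :=
  |(LinearMap.det ((A : Plane →L[ℝ] Plane) : Plane →ₗ[ℝ] Plane))⁻¹|

theorem detFactor_pos (A : Plane ≃L[ℝ] Plane) : 0 < detFactor A :=
  abs_pos.2 (inv_ne_zero (A.toLinearEquiv.isUnit_det'.ne_zero))

theorem map_affine (A : Plane ≃L[ℝ] Plane) (b : Plane) :
    Measure.map (fun x => A x + b) (volume : Measure Plane) =
      ENNReal.ofReal (detFactor A) • volume := by
  have h1 : Measure.map A (volume : Measure Plane) = ENNReal.ofReal (detFactor A) • volume :=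
    Measure.map_linearMap_addHaar_eq_smul_addHaar volume
      (f := ((A : Plane →L[ℝ] Plane) : Plane →ₗ[ℝ] Plane)) A.toLinearEquiv.isUnit_det'.ne_zero
  have h2 : Measure.map (fun x => A x + b) (volume : Measure Plane) =
      Measure.map (fun y => y + b) (Measure.map A volume) :=
    (Measure.map_map (measurable_add_const b) A.continuous.measurable).symm
  rw [h2, h1, Measure.map_smul, map_add_right_eq_self]

theorem measurable_affine (A : Plane ≃L[ℝ] Plane) (b : Plane) : Measurable fun x => A x + b :=
  (A.continuous.add continuous_const).measurable

/-- Composition with the affine map `x ↦ A x + b`. -/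
noncomputable def affineOp (A : Plane ≃L[ℝ] Plane) (b : Plane) : L2Plane →L[ℂ] L2Plane :=
  compOp (measurable_affine A b) (detFactor_pos A) (map_affine A b)

theorem coeFn_affineOp (A : Plane ≃L[ℝ] Plane) (b : Plane) (u : L2Plane) :
    affineOp A b u =ᵐ[volume] fun x => u (A x + b) :=
  coeFn_compOp _ _ _ _

theorem exists_schwartz_comp_affine (A : Plane ≃L[ℝ] Plane) (b : Plane)
    (s : SchwartzMap Plane ℂ) : ∃ s' : SchwartzMap Plane ℂ, ∀ x, s' x = s (A x + b) := by
  have h1 : Function.HasTemperateGrowth fun x => A x + b :=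
    (A : Plane →L[ℝ] Plane).hasTemperateGrowth.add (Function.HasTemperateGrowth.const b)
  have h2 : AntilipschitzWith _ fun x => A x + b := fun x y => by
    rw [edist_add_right]
    exact A.antilipschitz x y
  exact ⟨SchwartzMap.compCLMOfAntilipschitz ℂ h1 h2 s, fun _ => rfl⟩

theorem fourier_schwartz_comp_affine {A At : Plane ≃L[ℝ] Plane}
    (hA : ∀ x y, inner ℝ (A x) y = inner ℝ x (At y)) (b : Plane) (s s' : SchwartzMap Plane ℂ)
    (hs : ∀ x, s' x = s (A x + b)) (ξ : Plane) :
    𝓕 s' ξ = (detFactor A : ℂ) * (Complex.exp ((2 * Real.pi * inner ℝ b (At.symm ξ) : ℝ) * Complex.I) *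
      𝓕 s (At.symm ξ)) := by
  rw [SchwartzMap.fourier_coe, SchwartzMap.fourier_coe, Real.fourier_eq', Real.fourier_eq']
  have key : ∀ x, Complex.exp (((-2 * Real.pi * inner ℝ x ξ : ℝ) : ℂ) * Complex.I) • s' x =
      Complex.exp ((2 * Real.pi * inner ℝ b (At.symm ξ) : ℝ) * Complex.I) *
      (Complex.exp (((-2 * Real.pi * inner ℝ (A x + b) (At.symm ξ) : ℝ) : ℂ) * Complex.I) •
        s (A x + b)) := by
    intro x
    rw [hs, smul_eq_mul, smul_eq_mul, ← mul_assoc, ← Complex.exp_add, inner_add_left, hA,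
      ContinuousLinearEquiv.apply_symm_apply]
    congr 2
    push_cast
    ring
  simp_rw [key]
  rw [integral_const_mul]
  have hcont : Continuous fun y : Plane => Complex.exp (((-2 * Real.pi *
      inner ℝ y (At.symm ξ) : ℝ) : ℂ) * Complex.I) • s y := by
    have := s.continuous
    fun_prop
  have h1 := integral_map (μ := (volume : Measure Plane)) (measurable_affine A b).aemeasurable
    (f := fun y : Plane => Complex.exp (((-2 * Real.pi *
      inner ℝ y (At.symm ξ) : ℝ) : ℂ) * Complex.I) • s y) hcont.aestronglyMeasurable
  rw [← h1, map_affine, integral_smul_measure, ENNReal.toReal_ofReal (detFactor_pos A).le,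
    Complex.real_smul]
  ring

theorem measurable_affineChar (A : Plane ≃L[ℝ] Plane) (b : Plane) : Measurable fun ξ : Plane =>
    Complex.exp ((2 * Real.pi * inner ℝ b (A ξ) : ℝ) * Complex.I) :=
  Continuous.measurable (by fun_prop)

/-- The affine change of variables formula holds on Schwartz functions and extends to L² by density;
the translation contributes only a unimodular phase, which the norm discards. -/
theorem norm_fourier_affineOp {A At : Plane ≃L[ℝ] Plane}
    (hA : ∀ x y, inner ℝ (A x) y = inner ℝ x (At y)) (b : Plane) (u : L2Plane) :
    ∀ᵐ ξ : Plane, ‖(𝓕 (affineOp A b u) : L2Plane) ξ‖ =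
      detFactor A * ‖(𝓕 u : L2Plane) (At.symm ξ)‖ := by
  have hb : ∀ ξ : Plane, ‖Complex.exp ((2 * Real.pi * inner ℝ b (At.symm ξ) : ℝ) * Complex.I)‖ ≤ 1 :=
    fun ξ => (Complex.norm_exp_ofReal_mul_I _).le
  set M := mulOp _ (measurable_affineChar At.symm b) 1 hb with hM
  set Fo : L2Plane →L[ℂ] L2Plane :=
    (fourierL2.toContinuousLinearEquiv : L2Plane →L[ℂ] L2Plane) with hFo
  have heq : Fo ∘L affineOp A b = (detFactor A : ℂ) • (M ∘L affineOp At.symm 0 ∘L Fo) := by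
    refine clm_ext_schwartz fun s => ?_
    obtain ⟨s', hs'⟩ := exists_schwartz_comp_affine A b s
    have h1 : affineOp A b (s.toLp 2) = s'.toLp 2 := by
      apply Lp.ext
      filter_upwards [coeFn_affineOp A b (s.toLp 2), s'.coeFn_toLp 2 volume,
        (quasiMeasurePreserving_of_map_eq (measurable_affine A b) (map_affine A b)).ae_eq_comp
          (s.coeFn_toLp 2 volume)] with x e1 e2 e3
      rw [e1, e2, hs']
      exact e3
    have h2 : Fo (s'.toLp 2) = (𝓕 s').toLp 2 := SchwartzMap.toLp_fourier_eq s'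
    have h3 : Fo (s.toLp 2) = (𝓕 s).toLp 2 := SchwartzMap.toLp_fourier_eq s
    rw [ContinuousLinearMap.comp_apply, h1, h2, smul_apply,
      ContinuousLinearMap.comp_apply, ContinuousLinearMap.comp_apply, h3]
    apply Lp.ext
    filter_upwards [(𝓕 s').coeFn_toLp 2 volume,
      Lp.coeFn_smul (detFactor A : ℂ) (M (affineOp At.symm 0 ((𝓕 s).toLp 2))),
      coeFn_mulOp _ (measurable_affineChar At.symm b) 1 hb (affineOp At.symm 0 ((𝓕 s).toLp 2)),
      coeFn_affineOp At.symm 0 ((𝓕 s).toLp 2),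
      (quasiMeasurePreserving_of_map_eq (measurable_affine At.symm 0)
        (map_affine At.symm 0)).ae_eq_comp ((𝓕 s).coeFn_toLp 2 volume)] with ξ e1 e2 e3 e4 e5
    rw [e1, e2, Pi.smul_apply, e3, e4, fourier_schwartz_comp_affine hA b s s' hs', smul_eq_mul]
    have e6 : ((𝓕 s).toLp 2 volume) (At.symm ξ + 0) = 𝓕 s (At.symm ξ + 0) := e5
    rw [e6, add_zero]
  have h := DFunLike.congr_fun heq u
  have h' : (𝓕 (affineOp A b u) : L2Plane) =
      (detFactor A : ℂ) • M (affineOp At.symm 0 (𝓕 u : L2Plane)) := h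
  rw [h']
  filter_upwards [Lp.coeFn_smul (detFactor A : ℂ) (M (affineOp At.symm 0 (𝓕 u : L2Plane))),
    coeFn_mulOp _ (measurable_affineChar At.symm b) 1 hb (affineOp At.symm 0 (𝓕 u : L2Plane)),
    coeFn_affineOp At.symm 0 (𝓕 u : L2Plane)] with ξ e2 e3 e4
  rw [e2, Pi.smul_apply, e3, e4, norm_smul, norm_mul, Complex.norm_exp_ofReal_mul_I, one_mul,
    Complex.norm_real, Real.norm_of_nonneg (detFactor_pos A).le, add_zero]

end AffineMaps

/-! ### Energy under affine transplantation. -/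

section AffineEnergy

theorem detFactor_mul_detFactor_symm {A At : Plane ≃L[ℝ] Plane}
    (hA : ∀ x y, inner ℝ (A x) y = inner ℝ x (At y)) : detFactor A * detFactor At.symm = 1 := by
  have hadj : ((At : Plane →L[ℝ] Plane) : Plane →ₗ[ℝ] Plane) =
      LinearMap.adjoint ((A : Plane →L[ℝ] Plane) : Plane →ₗ[ℝ] Plane) := by
    rw [LinearMap.eq_adjoint_iff]
    intro x y
    change inner ℝ (At x) y = inner ℝ x (A y)
    rw [real_inner_comm, ← hA, real_inner_comm]
  have hdet : LinearMap.det ((At : Plane →L[ℝ] Plane) : Plane →ₗ[ℝ] Plane) =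
      LinearMap.det ((A : Plane →L[ℝ] Plane) : Plane →ₗ[ℝ] Plane) := by
    let e := EuclideanSpace.basisFun (Fin 2) ℝ
    rw [hadj, ← LinearMap.det_toMatrix e.toBasis, LinearMap.toMatrix_adjoint,
      Matrix.det_conjTranspose, LinearMap.det_toMatrix]
    rfl
  have hsymm : LinearMap.det ((At.symm : Plane →L[ℝ] Plane) : Plane →ₗ[ℝ] Plane) *
      LinearMap.det ((At : Plane →L[ℝ] Plane) : Plane →ₗ[ℝ] Plane) = 1 :=
    At.toLinearEquiv.det_symm_mul_det
  rw [hdet] at hsymm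
  rw [detFactor, detFactor, ← abs_mul, ← mul_inv, mul_comm, hsymm, inv_one, abs_one]

/-- The squared transform contributes `detFactor A` twice, and the substitution ξ = At η contributes
its inverse once, because A and its adjoint have the same determinant. -/
theorem lintegral_norm_fourier_affineOp {A At : Plane ≃L[ℝ] Plane}
    (hA : ∀ x y, inner ℝ (A x) y = inner ℝ x (At y)) (b : Plane) (u : L2Plane) {F : Plane → ℝ}
    (hF : Measurable F) :
    ∫⁻ ξ, ENNReal.ofReal (F ξ * ‖(𝓕 (affineOp A b u) : L2Plane) ξ‖ ^ 2) =
      ENNReal.ofReal (detFactor A) *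
        ∫⁻ η, ENNReal.ofReal (F (At η) * ‖(𝓕 u : L2Plane) η‖ ^ 2) := by
  have hpos := detFactor_pos A
  have hpos' := detFactor_pos At.symm
  have hmeas : AEMeasurable (fun η => ENNReal.ofReal (F (At η) * ‖(𝓕 u : L2Plane) η‖ ^ 2))
      (volume : Measure Plane) :=
    ((hF.comp At.continuous.measurable).aemeasurable.mul
      ((Lp.aestronglyMeasurable _).norm.aemeasurable.pow_const 2)).ennreal_ofReal
  have h1 : ∀ᵐ ξ : Plane, ENNReal.ofReal (F ξ * ‖(𝓕 (affineOp A b u) : L2Plane) ξ‖ ^ 2) =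
      ENNReal.ofReal (detFactor A ^ 2) * (fun η => ENNReal.ofReal (F (At η) *
        ‖(𝓕 u : L2Plane) η‖ ^ 2)) (At.symm ξ + 0) := by
    filter_upwards [norm_fourier_affineOp hA b u] with ξ hξ
    rw [hξ, ← ENNReal.ofReal_mul (by positivity), add_zero, ContinuousLinearEquiv.apply_symm_apply]
    congr 1
    ring
  rw [lintegral_congr_ae h1, lintegral_const_mul' _ _ ENNReal.ofReal_ne_top,
    ← lintegral_map' (μ := (volume : Measure Plane)) (f := fun η => ENNReal.ofReal (F (At η) *
        ‖(𝓕 u : L2Plane) η‖ ^ 2)) (g := fun ξ => At.symm ξ + 0)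
      (by rw [map_affine]; exact hmeas.smul_measure _) (measurable_affine At.symm 0).aemeasurable,
    map_affine, lintegral_smul_measure, smul_eq_mul, ← mul_assoc,
    ← ENNReal.ofReal_mul (by positivity)]
  congr 2
  rw [sq, mul_assoc, detFactor_mul_detFactor_symm hA, mul_one]

theorem fracEnergy_affineOp {A At : Plane ≃L[ℝ] Plane}
    (hA : ∀ x y, inner ℝ (A x) y = inner ℝ x (At y)) (α : ℝ) (b : Plane) (u : L2Plane) :
    fracEnergy α (affineOp A b u) = ENNReal.ofReal (detFactor A) *
      ∫⁻ η, ENNReal.ofReal (fracSymbol α (At η) * ‖(𝓕 u : L2Plane) η‖ ^ 2) :=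
  lintegral_norm_fourier_affineOp hA b u (measurable_fracSymbol α)

theorem fracSymbol_clm_le {α : ℝ} (h0 : 0 < α) (T : Plane →L[ℝ] Plane) (η : Plane) :
    fracSymbol α (T η) ≤ ‖T‖ ^ α * fracSymbol α η := by
  unfold fracSymbol
  have hpi := Real.pi_pos
  rw [← Real.mul_rpow (norm_nonneg _) (by positivity)]
  refine Real.rpow_le_rpow (by positivity) ?_ h0.le
  have := T.le_opNorm η
  calc 2 * Real.pi * ‖T η‖ ≤ 2 * Real.pi * (‖T‖ * ‖η‖) := by gcongr
    _ = _ := by ring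

theorem fracEnergy_affineOp_le {A At : Plane ≃L[ℝ] Plane}
    (hA : ∀ x y, inner ℝ (A x) y = inner ℝ x (At y)) {α : ℝ} (h0 : 0 < α) (b : Plane)
    (u : L2Plane) : fracEnergy α (affineOp A b u) ≤ ENNReal.ofReal (detFactor A) *
      (ENNReal.ofReal (‖(At : Plane →L[ℝ] Plane)‖ ^ α) * fracEnergy α u) := by
  have h : ∫⁻ η, ENNReal.ofReal (fracSymbol α (At η) * ‖(𝓕 u : L2Plane) η‖ ^ 2) ≤
      ENNReal.ofReal (‖(At : Plane →L[ℝ] Plane)‖ ^ α) * fracEnergy α u := by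
    rw [fracEnergy, ← lintegral_const_mul' _ _ ENNReal.ofReal_ne_top]
    refine lintegral_mono fun η => ?_
    rw [← ENNReal.ofReal_mul (Real.rpow_nonneg (norm_nonneg _) _), ← mul_assoc]
    exact ENNReal.ofReal_le_ofReal (mul_le_mul_of_nonneg_right
      (fracSymbol_clm_le h0 (At : Plane →L[ℝ] Plane) η) (sq_nonneg _))
  rw [fracEnergy_affineOp hA]
  gcongr

theorem norm_affineOp (A : Plane ≃L[ℝ] Plane) (b : Plane) (u : L2Plane) :
    ‖affineOp A b u‖ = √(detFactor A) * ‖u‖ :=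
  norm_compOp _ _ _ u

/-- Test functions pull back to test functions, and both parts of the Sobolev norm grow by at most
the factor K, so the approximation tolerance is divided by K. -/
theorem memH0_affineOp {A At : Plane ≃L[ℝ] Plane}
    (hA : ∀ x y, inner ℝ (A x) y = inner ℝ x (At y)) {α : ℝ} (h0 : 0 < α) (b : Plane)
    {Ω : Set Plane} {u : L2Plane} (hu : MemH0 α Ω u) :
    MemH0 α ((fun x => A x + b) ⁻¹' Ω) (affineOp A b u) := by
  intro ε hε
  set K : ℝ≥0∞ := ENNReal.ofReal (detFactor A) *
    max 1 (ENNReal.ofReal (‖(At : Plane →L[ℝ] Plane)‖ ^ α)) with hK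
  have hK0 : K ≠ 0 := mul_ne_zero (by simpa using detFactor_pos A) (by simp)
  have hKtop : K ≠ ⊤ := ENNReal.mul_ne_top ENNReal.ofReal_ne_top (by simp)
  obtain ⟨φ, hφ, h1, h2, h3, h4⟩ := hu (ε / K) (ENNReal.div_pos hε.ne' hKtop)
  have hcont : Continuous fun x => A x + b := A.continuous.add continuous_const
  let f : Plane ≃ₜ Plane := A.toHomeomorph.trans (Homeomorph.addRight b)
  have k1 : ContDiff ℝ ∞ (fun x => φ (A x + b)) :=
    h1.comp (A.contDiff.add contDiff_const)
  have k2 : HasCompactSupport (fun x => φ (A x + b)) := h2.comp_homeomorph f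
  have k3 : tsupport (fun x => φ (A x + b)) ⊆ (fun x => A x + b) ⁻¹' Ω := by
    refine (closure_minimal ?_ ((isClosed_tsupport φ).preimage hcont)).trans (Set.preimage_mono h3)
    intro x hx
    exact subset_tsupport φ hx
  have hψ : MemLp (fun x => φ (A x + b)) 2 (volume : Measure Plane) :=
    k1.continuous.memLp_of_hasCompactSupport k2
  refine ⟨_, hψ, k1, k2, k3, ?_⟩
  have heq : hψ.toLp = affineOp A b hφ.toLp := by
    apply Lp.ext
    filter_upwards [hψ.coeFn_toLp, coeFn_affineOp A b hφ.toLp,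
      (quasiMeasurePreserving_of_map_eq (measurable_affine A b) (map_affine A b)).ae_eq_comp
        hφ.coeFn_toLp] with x e1 e2 e3
    rw [e1, e2]
    exact e3.symm
  rw [heq, ← map_sub]
  set w := u - hφ.toLp
  calc ENNReal.ofReal (‖affineOp A b w‖ ^ 2) + fracEnergy α (affineOp A b w)
      ≤ ENNReal.ofReal (detFactor A) * ENNReal.ofReal (‖w‖ ^ 2) +
        ENNReal.ofReal (detFactor A) *
          (ENNReal.ofReal (‖(At : Plane →L[ℝ] Plane)‖ ^ α) * fracEnergy α w) := by
        refine add_le_add (le_of_eq ?_) (fracEnergy_affineOp_le hA h0 b w)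
        rw [norm_affineOp, mul_pow, Real.sq_sqrt (detFactor_pos A).le,
          ENNReal.ofReal_mul (detFactor_pos A).le]
    _ ≤ ENNReal.ofReal (detFactor A) *
          (max 1 (ENNReal.ofReal (‖(At : Plane →L[ℝ] Plane)‖ ^ α)) * ENNReal.ofReal (‖w‖ ^ 2)) +
        ENNReal.ofReal (detFactor A) *
          (max 1 (ENNReal.ofReal (‖(At : Plane →L[ℝ] Plane)‖ ^ α)) * fracEnergy α w) := by
        gcongr
        · calc ENNReal.ofReal (‖w‖ ^ 2) = 1 * ENNReal.ofReal (‖w‖ ^ 2) := (one_mul _).symm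
            _ ≤ _ := by gcongr; exact le_max_left _ _
        · exact le_max_right _ _
    _ = (ENNReal.ofReal (‖w‖ ^ 2) + fracEnergy α w) * K := by rw [hK]; ring
    _ < ε := by
        rw [ENNReal.lt_div_iff_mul_lt (Or.inl hK0) (Or.inl hKtop)] at h4
        exact h4

theorem fracEnergy_smul (α : ℝ) (a : ℂ) (u : L2Plane) :
    fracEnergy α (a • u) = ENNReal.ofReal (‖a‖ ^ 2) * fracEnergy α u := by
  rw [fracEnergy, fracEnergy, ← lintegral_const_mul' _ _ ENNReal.ofReal_ne_top]
  have h : (𝓕 (a • u) : L2Plane) = a • (𝓕 u : L2Plane) := fourierL2.map_smul a u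
  refine lintegral_congr_ae ?_
  rw [h]
  filter_upwards [Lp.coeFn_smul a (𝓕 u : L2Plane)] with ξ hξ
  rw [hξ, Pi.smul_apply, norm_smul, ← ENNReal.ofReal_mul (by positivity)]
  congr 1
  ring

theorem memH0_smul {α : ℝ} (h0 : 0 < α) (h1 : α ≤ 1) {Ω : Set Plane} (a : ℂ) {u : L2Plane}
    (hu : MemH0 α Ω u) : MemH0 α Ω (a • u) := by
  obtain ⟨g, rfl⟩ := (memH0_iff_exists_energyInclusion h0 h1 Ω u).1 hu
  exact (memH0_iff_exists_energyInclusion h0 h1 Ω _).2 ⟨a • g, map_smul _ _ _⟩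

/-- Orthonormal functions in `H₀(Ω)` are transplanted to an affine preimage of `Ω`. -/
theorem exists_orthonormal_transplant {A At : Plane ≃L[ℝ] Plane}
    (hA : ∀ x y, inner ℝ (A x) y = inner ℝ x (At y)) {α : ℝ} (h0 : 0 < α) (h1 : α ≤ 1) (b : Plane)
    {Ω : Set Plane} {ι : Type*} {u : ι → L2Plane} (hu : Orthonormal ℂ u)
    (hmem : ∀ j, MemH0 α Ω (u j)) :
    ∃ v : ι → L2Plane, Orthonormal ℂ v ∧ (∀ j, MemH0 α ((fun x => A x + b) ⁻¹' Ω) (v j)) ∧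
      ∀ j, fracEnergy α (v j) =
        ∫⁻ η, ENNReal.ofReal (fracSymbol α (At η) * ‖(𝓕 (u j) : L2Plane) η‖ ^ 2) := by
  classical
  have hd := detFactor_pos A
  have hs := Real.sqrt_pos.2 hd
  have hsq : ((√(detFactor A) : ℝ) : ℂ) * ((√(detFactor A) : ℝ) : ℂ) = (detFactor A : ℂ) := by
    rw [← Complex.ofReal_mul, Real.mul_self_sqrt hd.le]
  have hne : ((√(detFactor A) : ℝ) : ℂ) ≠ 0 := by exact_mod_cast hs.ne'
  refine ⟨fun j => ((√(detFactor A) : ℝ) : ℂ)⁻¹ • affineOp A b (u j), ?_,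
    fun j => memH0_smul h0 h1 _ (memH0_affineOp hA h0 b (hmem j)), fun j => ?_⟩
  · rw [orthonormal_iff_ite] at hu ⊢
    intro i j
    have h2 : inner ℂ (affineOp A b (u i)) (affineOp A b (u j)) =
        (detFactor A : ℂ) * inner ℂ (u i) (u j) := inner_compOp _ _ _ _ _
    rw [inner_smul_left, inner_smul_right, h2, hu, ← hsq, map_inv₀, Complex.conj_ofReal]
    field_simp
  · rw [fracEnergy_smul, fracEnergy_affineOp hA, ← mul_assoc, ← ENNReal.ofReal_mul (by positivity),
      norm_inv, Complex.norm_real, Real.norm_of_nonneg hs.le, inv_pow, Real.sq_sqrt hd.le,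
      inv_mul_cancel₀ hd.ne', ENNReal.ofReal_one, one_mul]

end AffineEnergy

/-! ### Linear maps diagonal between two orthonormal bases. -/

section DiagonalMaps

theorem sum_inner_basis (e : OrthonormalBasis (Fin 2) ℝ Plane) (x : Plane) :
    (inner ℝ (e 0) x : ℝ) • e 0 + (inner ℝ (e 1) x : ℝ) • e 1 = x := by
  have := e.sum_repr' x
  rwa [Fin.sum_univ_two] at this

theorem inner_basis_combination (e : OrthonormalBasis (Fin 2) ℝ Plane) (s t : ℝ) :
    inner ℝ (e 0) (s • e 0 + t • e 1) = s ∧ inner ℝ (e 1) (s • e 0 + t • e 1) = t := by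
  have h := orthonormal_iff_ite.1 e.orthonormal
  simp [inner_add_right, inner_smul_right, h]

theorem norm_basis_combination_sq (e : OrthonormalBasis (Fin 2) ℝ Plane) (s t : ℝ) :
    ‖s • e 0 + t • e 1‖ ^ 2 = s ^ 2 + t ^ 2 := by
  obtain ⟨h0, h1⟩ := inner_basis_combination e s t
  have := e.sum_sq_norm_inner_right (s • e 0 + t • e 1)
  rw [Fin.sum_univ_two, h0, h1] at this
  rw [← this]
  simp

/-- The linear map that sends the orthonormal basis `e` to the multiples `s`, `t` of the
orthonormal basis `d`. -/
noncomputable def diagMap (e d : OrthonormalBasis (Fin 2) ℝ Plane) (s t : ℝ) : Plane →ₗ[ℝ] Plane where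
  toFun x := (s * inner ℝ (e 0) x) • d 0 + (t * inner ℝ (e 1) x) • d 1
  map_add' x y := by
    simp only [inner_add_right, mul_add, add_smul]
    abel
  map_smul' c x := by
    simp only [inner_smul_right, RingHom.id_apply, smul_add, smul_smul]
    congr 2 <;> ring

theorem diagMap_apply (e d : OrthonormalBasis (Fin 2) ℝ Plane) (s t : ℝ) (x : Plane) :
    diagMap e d s t x = (s * inner ℝ (e 0) x) • d 0 + (t * inner ℝ (e 1) x) • d 1 := rfl

theorem diagMap_diagMap (e d : OrthonormalBasis (Fin 2) ℝ Plane) {s t : ℝ} (hs : s ≠ 0)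
    (ht : t ≠ 0) (x : Plane) : diagMap d e s⁻¹ t⁻¹ (diagMap e d s t x) = x := by
  obtain ⟨h0, h1⟩ := inner_basis_combination d (s * inner ℝ (e 0) x) (t * inner ℝ (e 1) x)
  rw [diagMap_apply, diagMap_apply, h0, h1, inv_mul_cancel_left₀ hs, inv_mul_cancel_left₀ ht,
    sum_inner_basis]

/-- `diagMap` as a continuous linear equivalence. -/
noncomputable def diagEquiv (e d : OrthonormalBasis (Fin 2) ℝ Plane) {s t : ℝ} (hs : s ≠ 0)
    (ht : t ≠ 0) : Plane ≃L[ℝ] Plane :=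
  LinearEquiv.toContinuousLinearEquiv
    { diagMap e d s t with
      invFun := diagMap d e s⁻¹ t⁻¹
      left_inv := diagMap_diagMap e d hs ht
      right_inv := fun x => by
        have := diagMap_diagMap d e (inv_ne_zero hs) (inv_ne_zero ht) x
        rwa [inv_inv, inv_inv] at this }

theorem diagEquiv_apply (e d : OrthonormalBasis (Fin 2) ℝ Plane) {s t : ℝ} (hs : s ≠ 0)
    (ht : t ≠ 0) (x : Plane) :
    diagEquiv e d hs ht x = (s * inner ℝ (e 0) x) • d 0 + (t * inner ℝ (e 1) x) • d 1 := rfl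

/-- The adjoint keeps the scale factors and exchanges the two bases. -/
theorem inner_diagEquiv (e d : OrthonormalBasis (Fin 2) ℝ Plane) {s t : ℝ} (hs : s ≠ 0)
    (ht : t ≠ 0) (x y : Plane) :
    inner ℝ (diagEquiv e d hs ht x) y = inner ℝ x (diagEquiv d e hs ht y) := by
  rw [diagEquiv_apply, diagEquiv_apply, inner_add_left, inner_add_right, inner_smul_left,
    inner_smul_left, inner_smul_right, inner_smul_right, real_inner_comm x, real_inner_comm x]
  simp only [conj_trivial]
  ring

theorem norm_diagEquiv_sq (e d : OrthonormalBasis (Fin 2) ℝ Plane) {s t : ℝ} (hs : s ≠ 0)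
    (ht : t ≠ 0) (x : Plane) :
    ‖diagEquiv e d hs ht x‖ ^ 2 = (s * inner ℝ (e 0) x) ^ 2 + (t * inner ℝ (e 1) x) ^ 2 := by
  rw [diagEquiv_apply, norm_basis_combination_sq]

theorem detFactor_diagEquiv_self (e : OrthonormalBasis (Fin 2) ℝ Plane) {s t : ℝ} (hs : s ≠ 0)
    (ht : t ≠ 0) : detFactor (diagEquiv e e hs ht) = |(s * t)⁻¹| := by
  have h := orthonormal_iff_ite.1 e.orthonormal
  have hdet : LinearMap.det ((diagEquiv e e hs ht : Plane →L[ℝ] Plane) : Plane →ₗ[ℝ] Plane) =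
      s * t := by
    rw [← LinearMap.det_toMatrix e.toBasis, Matrix.det_fin_two]
    have hij : ∀ i j, LinearMap.toMatrix e.toBasis e.toBasis
        ((diagEquiv e e hs ht : Plane →L[ℝ] Plane) : Plane →ₗ[ℝ] Plane) i j =
        inner ℝ (e i) (diagEquiv e e hs ht (e j)) := by
      intro i j
      rw [LinearMap.toMatrix_apply, OrthonormalBasis.coe_toBasis_repr_apply,
        OrthonormalBasis.repr_apply_apply, OrthonormalBasis.coe_toBasis]
      rfl
    simp only [hij, diagEquiv_apply, inner_add_right, inner_smul_right, h]
    simp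
  rw [detFactor, hdet]

end DiagonalMaps

/-! ### Ellipses as affine preimages of disks. -/

section Ellipses

/-- The open region bounded by the ellipse with centre `c`, axes `e` and semiaxes `a`, `b`. -/
def ellipse (c : Plane) (e : OrthonormalBasis (Fin 2) ℝ Plane) (a b : ℝ) : Set Plane :=
  {x | (inner ℝ (e 0) (x - c)) ^ 2 / a ^ 2 + (inner ℝ (e 1) (x - c)) ^ 2 / b ^ 2 < 1}

theorem mem_ellipse {c : Plane} {e : OrthonormalBasis (Fin 2) ℝ Plane} {a b : ℝ} {x : Plane} :
    x ∈ ellipse c e a b ↔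
      (inner ℝ (e 0) (x - c)) ^ 2 / a ^ 2 + (inner ℝ (e 1) (x - c)) ^ 2 / b ^ 2 < 1 := Iff.rfl

/-- The target basis d is arbitrary because a disk has no preferred axes. This is the freedom over
which the energies are averaged. -/
theorem preimage_ball_eq_ellipse (c p : Plane) (e d : OrthonormalBasis (Fin 2) ℝ Plane)
    {a b r : ℝ} (ha : 0 < a) (hb : 0 < b) (hr : 0 < r) :
    (fun x => diagEquiv e d (div_pos hr ha).ne' (div_pos hr hb).ne' x +
      (p - diagEquiv e d (div_pos hr ha).ne' (div_pos hr hb).ne' c)) ⁻¹' Metric.ball p r =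
      ellipse c e a b := by
  ext x
  rw [Set.mem_preimage, mem_ball_iff_norm]
  have h1 : diagEquiv e d (div_pos hr ha).ne' (div_pos hr hb).ne' x +
      (p - diagEquiv e d (div_pos hr ha).ne' (div_pos hr hb).ne' c) - p =
      diagEquiv e d (div_pos hr ha).ne' (div_pos hr hb).ne' (x - c) := by
    rw [map_sub]; abel
  rw [h1, ← sq_lt_sq₀ (norm_nonneg _) hr.le, norm_diagEquiv_sq, mem_ellipse]
  have h2 : (r / a * inner ℝ (e 0) (x - c)) ^ 2 + (r / b * inner ℝ (e 1) (x - c)) ^ 2 =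
      r ^ 2 * ((inner ℝ (e 0) (x - c)) ^ 2 / a ^ 2 + (inner ℝ (e 1) (x - c)) ^ 2 / b ^ 2) := by
    field_simp
  rw [h2]
  have hr2 : 0 < r ^ 2 := by positivity
  constructor
  · intro h
    by_contra! hcon
    nlinarith
  · intro h
    nlinarith

theorem isOpen_ellipse (c : Plane) (e : OrthonormalBasis (Fin 2) ℝ Plane) (a b : ℝ) :
    IsOpen (ellipse c e a b) :=
  isOpen_lt (by fun_prop) continuous_const

theorem center_mem_ellipse (c : Plane) (e : OrthonormalBasis (Fin 2) ℝ Plane) (a b : ℝ) :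
    c ∈ ellipse c e a b := by
  simp [mem_ellipse]

theorem isBounded_ellipse (c : Plane) (e : OrthonormalBasis (Fin 2) ℝ Plane) {a b : ℝ}
    (ha : 0 < a) (hb : 0 < b) : Bornology.IsBounded (ellipse c e a b) := by
  rw [← preimage_ball_eq_ellipse c 0 e e ha hb one_pos]
  set A := diagEquiv e e (div_pos one_pos ha).ne' (div_pos one_pos hb).ne'
  have h := A.antilipschitz
  have h2 : AntilipschitzWith _ fun x => A x + (0 - A c) := fun x y => by
    rw [edist_add_right]
    exact h x y
  exact h2.isBounded_preimage Metric.isBounded_ball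

theorem area_ball (p : Plane) {r : ℝ} (hr : 0 < r) : area (Metric.ball p r) = Real.pi * r ^ 2 := by
  rw [area, EuclideanSpace.volume_ball_fin_two]
  simp [hr.le, ENNReal.toReal_ofReal Real.pi_pos.le]
  ring

theorem area_ellipse (c : Plane) (e : OrthonormalBasis (Fin 2) ℝ Plane) {a b : ℝ}
    (ha : 0 < a) (hb : 0 < b) : area (ellipse c e a b) = Real.pi * (a * b) := by
  rw [← preimage_ball_eq_ellipse c 0 e e ha hb one_pos, area,
    ← Measure.map_apply (measurable_affine _ _) Metric.isOpen_ball.measurableSet, map_affine,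
    Measure.smul_apply, smul_eq_mul, ENNReal.toReal_mul, ENNReal.toReal_ofReal (detFactor_pos _).le,
    detFactor_diagEquiv_self]
  have := area_ball (0 : Plane) one_pos
  rw [area] at this
  rw [this, abs_of_pos (by positivity)]
  field_simp

end Ellipses

/-! ### Averaging the symbol over rotations. -/

section RotationAverages

theorem orthonormal_rotated (θ : ℝ) :
    Orthonormal ℝ (![!₂[Real.cos θ, Real.sin θ], !₂[-Real.sin θ, Real.cos θ]] :
      Fin 2 → Plane) := by
  have h := Real.sin_sq_add_cos_sq θ
  have h' := Real.cos_sq_add_sin_sq θ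
  refine ⟨fun i => ?_, fun i j hij => ?_⟩
  · fin_cases i <;> simp [EuclideanSpace.norm_eq, Fin.sum_univ_two, h, h']
  · fin_cases i <;> fin_cases j <;>
      first
      | exact absurd rfl hij
      | (simp [PiLp.inner_apply, Fin.sum_univ_two]; ring)

/-- The standard basis rotated by the angle `θ`. -/
noncomputable def rotBasis (θ : ℝ) : OrthonormalBasis (Fin 2) ℝ Plane :=
  OrthonormalBasis.mk (orthonormal_rotated θ)
    ((orthonormal_rotated θ).linearIndependent.span_eq_top_of_card_eq_finrank' (by simp)).ge

theorem inner_rotBasis (θ : ℝ) (η : Plane) :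
    inner ℝ (rotBasis θ 0) η = Real.cos θ * η 0 + Real.sin θ * η 1 ∧
      inner ℝ (rotBasis θ 1) η = -Real.sin θ * η 0 + Real.cos θ * η 1 := by
  rw [rotBasis, OrthonormalBasis.coe_mk]
  simp [PiLp.inner_apply, Fin.sum_univ_two, mul_comm]

theorem exists_polar (η : Plane) :
    ∃ φ : ℝ, η 0 = ‖η‖ * Real.cos φ ∧ η 1 = ‖η‖ * Real.sin φ := by
  have hnorm : ‖(⟨η 0, η 1⟩ : ℂ)‖ = ‖η‖ := by
    rw [EuclideanSpace.norm_eq, Fin.sum_univ_two, Complex.norm_eq_sqrt_sq_add_sq]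
    simp
  refine ⟨Complex.arg ⟨η 0, η 1⟩, ?_, ?_⟩
  · rw [← hnorm, Complex.norm_mul_cos_arg]
  · rw [← hnorm, Complex.norm_mul_sin_arg]

/-- In polar coordinates, rotating the frame only shifts the angle of η, so the average over θ will
be the same for every direction of η. -/
theorem exists_norm_diagEquiv_rotBasis (e : OrthonormalBasis (Fin 2) ℝ Plane) {s t : ℝ}
    (hs : s ≠ 0) (ht : t ≠ 0) (η : Plane) : ∃ φ : ℝ, ∀ θ,
      ‖diagEquiv (rotBasis θ) e hs ht η‖ =
        ‖η‖ * √((s * Real.cos (θ - φ)) ^ 2 + (t * Real.sin (θ - φ)) ^ 2) := by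
  obtain ⟨φ, h0, h1⟩ := exists_polar η
  refine ⟨φ, fun θ => ?_⟩
  obtain ⟨k0, k1⟩ := inner_rotBasis θ η
  rw [← Real.sqrt_sq (norm_nonneg (diagEquiv (rotBasis θ) e hs ht η)), norm_diagEquiv_sq, k0, k1,
    h0, h1, Real.cos_sub, Real.sin_sub, ← Real.sqrt_sq (norm_nonneg η),
    ← Real.sqrt_mul (sq_nonneg _), Real.sqrt_sq (norm_nonneg η)]
  congr 1
  ring

/-- The length of an ellipse with semiaxes `a` and `b`. -/
noncomputable def ellipseLength (a b : ℝ) : ℝ :=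
  ∫ t in (0 : ℝ)..2 * Real.pi, √((a * Real.sin t) ^ 2 + (b * Real.cos t) ^ 2)

theorem sqrt_pos_of_semiaxes {a b : ℝ} (ha : 0 < a) (hb : 0 < b) (t : ℝ) :
    0 < √((a * Real.sin t) ^ 2 + (b * Real.cos t) ^ 2) := by
  rw [Real.sqrt_pos]
  rcases eq_or_ne (Real.sin t) 0 with h | h
  · have : Real.cos t ^ 2 = 1 := by have := Real.sin_sq_add_cos_sq t; rw [h] at this; linarith
    rw [h, mul_pow b, this]
    positivity
  · positivity

theorem ellipseLength_pos {a b : ℝ} (ha : 0 < a) (hb : 0 < b) : 0 < ellipseLength a b :=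
  intervalIntegral.intervalIntegral_pos_of_pos (Continuous.intervalIntegrable (by fun_prop) _ _)
    (sqrt_pos_of_semiaxes ha hb) Real.two_pi_pos

/-- By concavity the graph lies below its tangent at m; in normalised form this is Bernoulli's
inequality. Integrating it with m the mean gives Jensen's inequality. -/
theorem rpow_le_tangent {α : ℝ} (h0 : 0 < α) (h1 : α ≤ 1) {m x : ℝ} (hm : 0 < m) (hx : 0 ≤ x) :
    x ^ α ≤ m ^ α * (1 - α + α * (x / m)) := by
  have h := rpow_one_add_le_one_add_mul_self (s := x / m - 1)
    (by linarith [div_nonneg hx hm.le]) h0.le h1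
  rw [add_sub_cancel, Real.div_rpow hx hm.le, div_le_iff₀ (Real.rpow_pos_of_pos hm α)] at h
  linarith

/-- The mean of `x ↦ x ^ α` over the radii of an ellipse is at most the power of the mean. -/
theorem integral_rpow_radius_le {α : ℝ} (h0 : 0 < α) (h1 : α ≤ 1) {a b r : ℝ} (ha : 0 < a)
    (hb : 0 < b) (hr : 0 < r) (φ : ℝ) :
    ∫ θ in (0 : ℝ)..2 * Real.pi,
      √((r / a * Real.cos (θ - φ)) ^ 2 + (r / b * Real.sin (θ - φ)) ^ 2) ^ α ≤
      2 * Real.pi * (r * ellipseLength a b / (2 * Real.pi * (a * b))) ^ α := by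
  set q : ℝ → ℝ := fun t => √((r / a * Real.cos t) ^ 2 + (r / b * Real.sin t) ^ 2) with hq
  -- The decisive coincidence: the radius being averaged is proportional to the speed of the
  -- parametrised ellipse, so its mean is a multiple of the length.
  have hq' : ∀ t, q t = r / (a * b) * √((a * Real.sin t) ^ 2 + (b * Real.cos t) ^ 2) := by
    intro t
    have h : 0 ≤ r / (a * b) := by positivity
    have h2 : r / (a * b) * √((a * Real.sin t) ^ 2 + (b * Real.cos t) ^ 2) =
        √((r / (a * b)) ^ 2 * ((a * Real.sin t) ^ 2 + (b * Real.cos t) ^ 2)) := by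
      rw [Real.sqrt_mul (sq_nonneg _), Real.sqrt_sq h]
    rw [h2]
    change √_ = √_
    congr 1
    field_simp
    ring
  have hqc : Continuous q := by fun_prop
  have hq0 : ∀ t, 0 ≤ q t := fun t => Real.sqrt_nonneg _
  set m := r * ellipseLength a b / (2 * Real.pi * (a * b)) with hm
  have hpi := Real.pi_pos
  have hL := ellipseLength_pos ha hb
  have hm0 : 0 < m := by positivity
  have hint : ∫ t in (0 : ℝ)..2 * Real.pi, q t = 2 * Real.pi * m := by
    simp_rw [hq']
    rw [intervalIntegral.integral_const_mul, hm]
    change r / (a * b) * ellipseLength a b = _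
    field_simp
  have hper : Function.Periodic (fun t => q t ^ α) (2 * Real.pi) := fun t => by
    simp [hq, Real.cos_add_two_pi, Real.sin_add_two_pi]
  have hshift : ∫ θ in (0 : ℝ)..2 * Real.pi, q (θ - φ) ^ α =
      ∫ t in (0 : ℝ)..2 * Real.pi, q t ^ α := by
    rw [intervalIntegral.integral_comp_sub_right (fun t => q t ^ α)]
    have := hper.intervalIntegral_add_eq (0 - φ) 0
    rw [zero_add] at this
    rw [← this]
    congr 1
    ring
  have hqα : Continuous fun t => q t ^ α := hqc.rpow_const fun _ => Or.inr h0.le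
  calc ∫ θ in (0 : ℝ)..2 * Real.pi, q (θ - φ) ^ α
      = ∫ t in (0 : ℝ)..2 * Real.pi, q t ^ α := hshift
    _ ≤ ∫ t in (0 : ℝ)..2 * Real.pi, m ^ α * (1 - α + α * (q t / m)) := by
        refine intervalIntegral.integral_mono_on Real.two_pi_pos.le
          (hqα.intervalIntegrable _ _) (Continuous.intervalIntegrable (by fun_prop) _ _)
          fun t _ => rpow_le_tangent h0 h1 hm0 (hq0 t)
    _ = 2 * Real.pi * m ^ α := by
        rw [intervalIntegral.integral_const_mul, intervalIntegral.integral_add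
          (Continuous.intervalIntegrable (by fun_prop) _ _)
          (Continuous.intervalIntegrable (by fun_prop) _ _), intervalIntegral.integral_const_mul,
          intervalIntegral.integral_div, hint, intervalIntegral.integral_const, smul_eq_mul]
        field_simp
        ring

theorem lintegral_fracSymbol_rotBasis_le {α : ℝ} (h0 : 0 < α) (h1 : α ≤ 1)
    (e : OrthonormalBasis (Fin 2) ℝ Plane) {a b r : ℝ} (ha : 0 < a) (hb : 0 < b) (hr : 0 < r)
    (η : Plane) :
    ∫⁻ θ in Set.Ioc 0 (2 * Real.pi), ENNReal.ofReal (fracSymbol α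
      (diagEquiv (rotBasis θ) e (div_pos hr ha).ne' (div_pos hr hb).ne' η)) ≤
      ENNReal.ofReal (2 * Real.pi * (r * ellipseLength a b / (2 * Real.pi * (a * b))) ^ α *
        fracSymbol α η) := by
  obtain ⟨φ, hφ⟩ := exists_norm_diagEquiv_rotBasis e (div_pos hr ha).ne' (div_pos hr hb).ne' η
  have hpi := Real.pi_pos
  have hsym : ∀ θ, fracSymbol α
      (diagEquiv (rotBasis θ) e (div_pos hr ha).ne' (div_pos hr hb).ne' η) = fracSymbol α η *
        √((r / a * Real.cos (θ - φ)) ^ 2 + (r / b * Real.sin (θ - φ)) ^ 2) ^ α := by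
    intro θ
    rw [fracSymbol, fracSymbol, hφ, ← mul_assoc, Real.mul_rpow (by positivity) (by positivity)]
  simp_rw [hsym]
  have hcont : Continuous fun θ => fracSymbol α η *
      √((r / a * Real.cos (θ - φ)) ^ 2 + (r / b * Real.sin (θ - φ)) ^ 2) ^ α :=
    continuous_const.mul (Continuous.rpow_const (by fun_prop) fun _ => Or.inr h0.le)
  rw [← ofReal_integral_eq_lintegral_ofReal]
  · refine ENNReal.ofReal_le_ofReal ?_
    rw [← intervalIntegral.integral_of_le Real.two_pi_pos.le, intervalIntegral.integral_const_mul,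
      mul_comm]
    exact mul_le_mul_of_nonneg_right (integral_rpow_radius_le h0 h1 ha hb hr φ)
      (fracSymbol_nonneg α η)
  · exact (intervalIntegrable_iff_integrableOn_Ioc_of_le Real.two_pi_pos.le).1
      (hcont.intervalIntegrable _ _)
  · exact Filter.Eventually.of_forall fun θ => mul_nonneg (fracSymbol_nonneg α η) (by positivity)

theorem measurable_fracSymbol_rotBasis (α : ℝ)
    (e : OrthonormalBasis (Fin 2) ℝ Plane) {s t : ℝ} (hs : s ≠ 0) (ht : t ≠ 0) :
    Measurable fun z : ℝ × Plane => fracSymbol α (diagEquiv (rotBasis z.1) e hs ht z.2) := by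
  have h : ∀ z : ℝ × Plane, fracSymbol α (diagEquiv (rotBasis z.1) e hs ht z.2) =
      (2 * Real.pi * √((s * (Real.cos z.1 * z.2 0 + Real.sin z.1 * z.2 1)) ^ 2 +
        (t * (-Real.sin z.1 * z.2 0 + Real.cos z.1 * z.2 1)) ^ 2)) ^ α := by
    intro z
    obtain ⟨k0, k1⟩ := inner_rotBasis z.1 z.2
    rw [fracSymbol, ← Real.sqrt_sq (norm_nonneg (diagEquiv (rotBasis z.1) e hs ht z.2)),
      norm_diagEquiv_sq, k0, k1]
  simp_rw [h]
  have hc : Continuous fun z : ℝ × Plane =>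
      2 * Real.pi * √((s * (Real.cos z.1 * z.2 0 + Real.sin z.1 * z.2 1)) ^ 2 +
        (t * (-Real.sin z.1 * z.2 0 + Real.cos z.1 * z.2 1)) ^ 2) := by fun_prop
  exact hc.measurable.pow_const α

end RotationAverages

/-! ### Comparison of eigenvalue sums of ellipse and disk. -/

section Comparison

/-- The ellipse's eigenvalue sums are controlled by those of the disk, by averaging the energies of
rotated and transplanted eigenfunctions. -/
theorem sum_energy_le {α : ℝ} (h0 : 0 < α) (h1 : α ≤ 1)
    {c p : Plane} {e : OrthonormalBasis (Fin 2) ℝ Plane} {a b r : ℝ} (ha : 0 < a) (hb : 0 < b)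
    (hr : 0 < r) {n : ℕ} {S : ℝ}
    (hS : ∀ v : Fin n → L2Plane, Orthonormal ℂ v → (∀ j, MemH0 α (ellipse c e a b) (v j)) →
      ENNReal.ofReal S ≤ ∑ j, fracEnergy α (v j))
    {u : Fin n → L2Plane} (hu : Orthonormal ℂ u) (hmem : ∀ j, MemH0 α (Metric.ball p r) (u j)) :
    ENNReal.ofReal S ≤
      ENNReal.ofReal ((r * ellipseLength a b / (2 * Real.pi * (a * b))) ^ α) *
        ∑ j, fracEnergy α (u j) := by
  set m := r * ellipseLength a b / (2 * Real.pi * (a * b)) with hm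
  have hpi := Real.two_pi_pos
  have hL := ellipseLength_pos ha hb
  have hm0 : 0 ≤ m ^ α := by positivity
  have hs := (div_pos hr ha).ne'
  have ht := (div_pos hr hb).ne'
  -- Each rotation angle gives an admissible orthonormal family on the same ellipse.
  have hθ : ∀ θ : ℝ, ENNReal.ofReal S ≤ ∑ j, ∫⁻ η, ENNReal.ofReal (fracSymbol α
      (diagEquiv (rotBasis θ) e hs ht η) * ‖(𝓕 (u j) : L2Plane) η‖ ^ 2) := by
    intro θ
    obtain ⟨v, hv, hvmem, hvE⟩ := exists_orthonormal_transplant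
      (inner_diagEquiv e (rotBasis θ) hs ht) h0 h1
      (p - diagEquiv e (rotBasis θ) hs ht c) hu hmem
    rw [preimage_ball_eq_ellipse c p e (rotBasis θ) ha hb hr] at hvmem
    have := hS v hv hvmem
    simp_rw [hvE] at this
    exact this
  have hmeas : ∀ j, Measurable fun z : ℝ × Plane => ENNReal.ofReal (fracSymbol α
      (diagEquiv (rotBasis z.1) e hs ht z.2) * ‖(𝓕 (u j) : L2Plane) z.2‖ ^ 2) := fun j =>
    ((measurable_fracSymbol_rotBasis α e hs ht).mul
      (((Lp.stronglyMeasurable (𝓕 (u j) : L2Plane)).measurable.comp measurable_snd).norm.pow_const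
        2)).ennreal_ofReal
  -- Tonelli moves the angular average inside the frequency integral, where it acts on the symbol
  -- alone.
  have hj : ∀ j, ∫⁻ θ in Set.Ioc 0 (2 * Real.pi), ∫⁻ η, ENNReal.ofReal (fracSymbol α
      (diagEquiv (rotBasis θ) e hs ht η) * ‖(𝓕 (u j) : L2Plane) η‖ ^ 2) ≤
      ENNReal.ofReal (2 * Real.pi * m ^ α) * fracEnergy α (u j) := by
    intro j
    rw [lintegral_lintegral_swap (hmeas j).aemeasurable, fracEnergy,
      ← lintegral_const_mul' _ _ ENNReal.ofReal_ne_top]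
    refine lintegral_mono fun η => ?_
    have hn : 0 ≤ ‖(𝓕 (u j) : L2Plane) η‖ ^ 2 := sq_nonneg _
    simp_rw [ENNReal.ofReal_mul (fracSymbol_nonneg _ _)]
    rw [lintegral_mul_const' _ _ ENNReal.ofReal_ne_top, ← mul_assoc,
      ← ENNReal.ofReal_mul (by positivity)]
    exact mul_le_mul_left (lintegral_fracSymbol_rotBasis_le h0 h1 e ha hb hr η) _
  have htotal : ENNReal.ofReal (2 * Real.pi) * ENNReal.ofReal S ≤
      ENNReal.ofReal (2 * Real.pi) * (ENNReal.ofReal (m ^ α) * ∑ j, fracEnergy α (u j)) := by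
    calc ENNReal.ofReal (2 * Real.pi) * ENNReal.ofReal S
        = ∫⁻ _ in Set.Ioc 0 (2 * Real.pi), ENNReal.ofReal S := by
          rw [setLIntegral_const, Real.volume_Ioc, sub_zero, mul_comm]
      _ ≤ ∫⁻ θ in Set.Ioc 0 (2 * Real.pi), ∑ j, ∫⁻ η, ENNReal.ofReal (fracSymbol α
            (diagEquiv (rotBasis θ) e hs ht η) * ‖(𝓕 (u j) : L2Plane) η‖ ^ 2) :=
          lintegral_mono fun θ => hθ θ
      _ = ∑ j, ∫⁻ θ in Set.Ioc 0 (2 * Real.pi), ∫⁻ η, ENNReal.ofReal (fracSymbol α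
            (diagEquiv (rotBasis θ) e hs ht η) * ‖(𝓕 (u j) : L2Plane) η‖ ^ 2) :=
          lintegral_finsetSum _ fun j _ => (hmeas j).lintegral_prod_right'
      _ ≤ ∑ j, ENNReal.ofReal (2 * Real.pi * m ^ α) * fracEnergy α (u j) :=
          Finset.sum_le_sum fun j _ => hj j
      _ = _ := by
          rw [← Finset.mul_sum, ENNReal.ofReal_mul hpi.le, mul_assoc]
  exact (ENNReal.mul_le_mul_iff_right (ENNReal.ofReal_pos.2 hpi).ne' ENNReal.ofReal_ne_top).1 htotal

theorem isEllipse_iff {E : Set Plane} : IsEllipse E ↔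
    ∃ (c : Plane) (e : OrthonormalBasis (Fin 2) ℝ Plane) (a b : ℝ), 0 < a ∧ 0 < b ∧
      E = ellipse c e a b := Iff.rfl

theorem fracEigenvalue_eq {α : ℝ} {Ω : Set Plane} {k : ℕ} {s : ℝ}
    (h : eigenvalueLevels α Ω k = Set.Ici s) : fracEigenvalue α Ω k = s := by
  rw [fracEigenvalue, h, csInf_Ici]

theorem isLeast_fracEigenvalue {α : ℝ} (h0 : 0 < α) (h1 : α ≤ 1) {Ω : Set Plane} (hΩ : IsOpen Ω)
    (hb : Bornology.IsBounded Ω) (hne : Ω.Nonempty) {k : ℕ} (hk : 1 ≤ k) :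
    IsLeast (eigenvalueLevels α Ω k) (fracEigenvalue α Ω k) := by
  obtain ⟨s, -, hs, -⟩ := exists_spectrum h0 h1 hΩ hb hne
  -- The spectral sequence is indexed from 0, the eigenvalues from 1.
  obtain ⟨j, rfl⟩ : ∃ j, k = j + 1 := ⟨k - 1, by omega⟩
  rw [fracEigenvalue_eq (hs j), hs j]
  exact isLeast_Ici

/-- Among ellipses, the sum of the first `n` eigenvalues compares with that of a disk through the
length of the ellipse. -/
theorem sum_fracEigenvalue_ellipse_le {α : ℝ} (h0 : 0 < α) (h1 : α ≤ 1)
    (c p : Plane) (e : OrthonormalBasis (Fin 2) ℝ Plane) {a b r : ℝ} (ha : 0 < a) (hb : 0 < b)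
    (hr : 0 < r) (n : ℕ) :
    0 ≤ ∑ k ∈ Finset.Icc 1 n, fracEigenvalue α (ellipse c e a b) k ∧
    0 ≤ ∑ k ∈ Finset.Icc 1 n, fracEigenvalue α (Metric.ball p r) k ∧
    ∑ k ∈ Finset.Icc 1 n, fracEigenvalue α (ellipse c e a b) k ≤
      (r * ellipseLength a b / (2 * Real.pi * (a * b))) ^ α *
        ∑ k ∈ Finset.Icc 1 n, fracEigenvalue α (Metric.ball p r) k := by
  obtain ⟨s, hs0, hs, -, hsum⟩ := exists_spectrum h0 h1 (isOpen_ellipse c e a b)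
    (isBounded_ellipse c e ha hb) ⟨c, center_mem_ellipse c e a b⟩
  obtain ⟨s', hs0', hs', ⟨u, hu, hE⟩, -⟩ := exists_spectrum h0 h1 (Metric.isOpen_ball (x := p) (ε := r))
    Metric.isBounded_ball ⟨p, Metric.mem_ball_self hr⟩
  have hicc : ∀ F : ℕ → ℝ, ∑ k ∈ Finset.Icc 1 n, F k = ∑ k ∈ Finset.range n, F (k + 1) := fun F => by
    rw [Finset.range_eq_Ico, Finset.sum_Ico_add' F 0 n 1]
    rfl
  have e1 : ∑ k ∈ Finset.Icc 1 n, fracEigenvalue α (ellipse c e a b) k =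
      ∑ k ∈ Finset.range n, s k := by
    rw [hicc]
    exact Finset.sum_congr rfl fun k _ => fracEigenvalue_eq (hs k)
  have e2 : ∑ k ∈ Finset.Icc 1 n, fracEigenvalue α (Metric.ball p r) k =
      ∑ k ∈ Finset.range n, s' k := by
    rw [hicc]
    exact Finset.sum_congr rfl fun k _ => fracEigenvalue_eq (hs' k)
  rw [e1, e2]
  have hn := Finset.sum_nonneg (s := Finset.range n) fun k _ => hs0' k
  refine ⟨Finset.sum_nonneg fun k _ => hs0 k, hn, ?_⟩
  have h := sum_energy_le h0 h1 (p := p) ha hb hr (hsum n)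
    (u := fun j : Fin n => u j) (hu.comp _ Fin.val_injective) fun j => (hE j).1
  have hL := ellipseLength_pos ha hb
  have hpi := Real.two_pi_pos
  simp_rw [fun j => (hE j).2] at h
  rw [Fin.sum_univ_eq_sum_range (fun k => ENNReal.ofReal (s' k)),
    ← ENNReal.ofReal_sum_of_nonneg fun k _ => hs0' k, ← ENNReal.ofReal_mul (by positivity),
    ENNReal.ofReal_le_ofReal_iff (by positivity)] at h
  exact h

end Comparison

/-! ### Hausdorff length of the boundary of an ellipse. -/

section Perimeter

/-- The standard parametrization of an ellipse. -/
noncomputable def ellipseCurve (c : Plane) (e : OrthonormalBasis (Fin 2) ℝ Plane) (a b t : ℝ) :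
    Plane := c + ((a * Real.cos t) • e 0 + (b * Real.sin t) • e 1)

theorem continuous_ellipseCurve (c : Plane) (e : OrthonormalBasis (Fin 2) ℝ Plane) (a b : ℝ) :
    Continuous (ellipseCurve c e a b) := by
  unfold ellipseCurve; fun_prop

/-- The point is approached along the radius from the centre, where the quadratic form equals s² and
stays below 1 for 0 ≤ s < 1. -/
theorem ellipseCurve_mem_frontier (c : Plane) (e : OrthonormalBasis (Fin 2) ℝ Plane) {a b : ℝ}
    (ha : 0 < a) (hb : 0 < b) (t : ℝ) :
    ellipseCurve c e a b t ∈ frontier (ellipse c e a b) := by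
  have hval : ∀ s : ℝ, c + s • (ellipseCurve c e a b t - c) ∈ ellipse c e a b ↔ s ^ 2 < 1 := by
    intro s
    obtain ⟨h0, h1⟩ := inner_basis_combination e (a * Real.cos t) (b * Real.sin t)
    rw [mem_ellipse, ellipseCurve, add_sub_cancel_left, add_sub_cancel_left, inner_smul_right,
      inner_smul_right, h0, h1]
    have : (s * (a * Real.cos t)) ^ 2 / a ^ 2 + (s * (b * Real.sin t)) ^ 2 / b ^ 2 = s ^ 2 := by
      have h2 := Real.cos_sq_add_sin_sq t
      field_simp
      rw [h2, mul_one]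
    rw [this]
  rw [(isOpen_ellipse c e a b).frontier_eq]
  constructor
  · have hcont : Continuous fun s : ℝ => c + s • (ellipseCurve c e a b t - c) := by fun_prop
    have h1 : (1 : ℝ) ∈ closure (Set.Ico (0 : ℝ) 1) := by
      rw [closure_Ico zero_ne_one]
      exact Set.right_mem_Icc.2 zero_le_one
    have := map_mem_closure hcont h1 (t := ellipse c e a b) fun s hs => (hval s).2 (by
      have := hs.1; have := hs.2; nlinarith)
    simpa using this
  · intro h
    have := (hval 1).1 (by simpa using h)
    norm_num at this

/-- The sum-to-product formulas give each chord exactly as a sine factor times the speed at the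
midpoint parameter. -/
theorem norm_ellipseCurve_sub (c : Plane) (e : OrthonormalBasis (Fin 2) ℝ Plane) (a b s t : ℝ) :
    ‖ellipseCurve c e a b t - ellipseCurve c e a b s‖ = 2 * |Real.sin ((t - s) / 2)| *
      √((a * Real.sin ((t + s) / 2)) ^ 2 + (b * Real.cos ((t + s) / 2)) ^ 2) := by
  have h1 : ellipseCurve c e a b t - ellipseCurve c e a b s =
      (a * (Real.cos t - Real.cos s)) • e 0 + (b * (Real.sin t - Real.sin s)) • e 1 := by
    unfold ellipseCurve
    module
  have h2 : 0 ≤ 2 * |Real.sin ((t - s) / 2)| := by positivity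
  rw [h1, ← Real.sqrt_sq (norm_nonneg _), norm_basis_combination_sq, Real.cos_sub_cos,
    Real.sin_sub_sin, ← Real.sqrt_sq h2, ← Real.sqrt_mul (sq_nonneg _)]
  congr 1
  rw [mul_pow 2 |_|, sq_abs]
  ring

/-- Distance to the starting point is 1-Lipschitz and, by the intermediate value theorem, maps the
arc onto a set containing an interval as long as the chord. -/
theorem ofReal_norm_sub_le_hausdorffMeasure {γ : ℝ → Plane} (hγ : Continuous γ) {s t : ℝ}
    (hst : s ≤ t) : ENNReal.ofReal ‖γ t - γ s‖ ≤ Measure.hausdorffMeasure 1 (γ '' Set.Ico s t) := by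
  have hl : LipschitzWith 1 fun x : Plane => dist x (γ s) := LipschitzWith.dist_left (γ s)
  have h1 := hl.hausdorffMeasure_image_le (d := 1) zero_le_one (γ '' Set.Ico s t)
  rw [ENNReal.coe_one, ENNReal.one_rpow, one_mul, hausdorffMeasure_real] at h1
  refine le_trans ?_ h1
  have hcont : ContinuousOn (fun x => dist (γ x) (γ s)) (Set.Icc s t) := by fun_prop
  have h2 := intermediate_value_Ico hst hcont
  rw [dist_self, dist_eq_norm] at h2
  rw [Set.image_image]
  refine le_trans ?_ (measure_mono h2)
  rw [Real.volume_Ico, sub_zero]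

theorem injOn_ellipseCurve (c : Plane) (e : OrthonormalBasis (Fin 2) ℝ Plane) {a b : ℝ}
    (ha : 0 < a) (hb : 0 < b) (φ : ℝ) :
    Set.InjOn (ellipseCurve c e a b) (Set.Ico φ (φ + 2 * Real.pi)) := by
  intro s hs t ht hst
  unfold ellipseCurve at hst
  have h := add_left_cancel hst
  obtain ⟨h0, h1⟩ := inner_basis_combination e (a * Real.cos s) (b * Real.sin s)
  obtain ⟨k0, k1⟩ := inner_basis_combination e (a * Real.cos t) (b * Real.sin t)
  rw [h, k0] at h0
  rw [h, k1] at h1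
  have hc := mul_left_cancel₀ ha.ne' h0
  have hs' := mul_left_cancel₀ hb.ne' h1
  have hang : ((t : ℝ) : Real.Angle) = (s : ℝ) := Real.Angle.cos_sin_inj hc hs'
  rw [Real.Angle.angle_eq_iff_two_pi_dvd_sub] at hang
  obtain ⟨k, hk⟩ := hang
  have hpi := Real.pi_pos
  have hk1 : (k : ℝ) < 1 := by
    by_contra! hcon
    have := hs.1; have := ht.2
    nlinarith
  have hk2 : (-1 : ℝ) < k := by
    by_contra! hcon
    have := hs.2; have := ht.1
    nlinarith
  have hk0 : k = 0 := by
    have h3 : k < 1 := by exact_mod_cast hk1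
    have h4 : -1 < k := by exact_mod_cast hk2
    omega
  rw [hk0] at hk
  simp at hk
  linarith

/-- Half-open parameter intervals and injectivity over one period make the arcs disjoint, so their
measures add up inside the frontier. -/
theorem sum_chords_le_hausdorffMeasure (c : Plane) (e : OrthonormalBasis (Fin 2) ℝ Plane)
    {a b : ℝ} (ha : 0 < a) (hb : 0 < b) (φ : ℝ) {N : ℕ} {h : ℝ} (hh : 0 < h)
    (hN : N * h = 2 * Real.pi) :
    ∑ i ∈ Finset.range N, ENNReal.ofReal ‖ellipseCurve c e a b (φ + (i + 1 : ℕ) * h) -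
      ellipseCurve c e a b (φ + i * h)‖ ≤
      Measure.hausdorffMeasure 1 (frontier (ellipse c e a b)) := by
  have hγ := continuous_ellipseCurve c e a b
  have hinj := injOn_ellipseCurve c e ha hb φ
  have hsub : ∀ i ∈ Finset.range N, Set.Ico (φ + i * h) (φ + (i + 1 : ℕ) * h) ⊆
      Set.Ico φ (φ + 2 * Real.pi) := by
    intro i hi
    have h1 : ((i + 1 : ℕ) : ℝ) ≤ N := by exact_mod_cast Finset.mem_range.1 hi
    refine Set.Ico_subset_Ico (by nlinarith [(Nat.cast_nonneg i : (0 : ℝ) ≤ i)]) ?_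
    rw [← hN]
    gcongr
  have hdisj : Set.PairwiseDisjoint (Finset.range N : Set ℕ) fun i : ℕ =>
      ellipseCurve c e a b '' Set.Ico (φ + i * h) (φ + (i + 1 : ℕ) * h) := by
    intro i hi j hj hij
    refine Disjoint.image ?_ hinj (hsub i hi) (hsub j hj)
    have hlt : ∀ i j : ℕ, i < j → Disjoint (Set.Ico (φ + i * h) (φ + (i + 1 : ℕ) * h))
        (Set.Ico (φ + j * h) (φ + (j + 1 : ℕ) * h)) := by
      intro i j hij
      rw [Set.disjoint_left]
      intro x hx hx'
      have h1 : ((i + 1 : ℕ) : ℝ) ≤ j := by exact_mod_cast hij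
      have := hx.2; have := hx'.1
      nlinarith
    rcases lt_or_gt_of_ne hij with h1 | h1
    · exact hlt i j h1
    · exact (hlt j i h1).symm
  calc ∑ i ∈ Finset.range N, ENNReal.ofReal ‖ellipseCurve c e a b (φ + (i + 1 : ℕ) * h) -
        ellipseCurve c e a b (φ + i * h)‖
      ≤ ∑ i ∈ Finset.range N, Measure.hausdorffMeasure 1
          (ellipseCurve c e a b '' Set.Ico (φ + i * h) (φ + (i + 1 : ℕ) * h)) := by
        refine Finset.sum_le_sum fun i _ => ofReal_norm_sub_le_hausdorffMeasure hγ ?_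
        push_cast
        nlinarith
    _ = Measure.hausdorffMeasure 1 (⋃ i ∈ Finset.range N,
          ellipseCurve c e a b '' Set.Ico (φ + i * h) (φ + (i + 1 : ℕ) * h)) :=
        (measure_biUnion_finset hdisj fun i hi => measurableSet_Ico.image_of_continuousOn_injOn
          hγ.continuousOn (hinj.mono (hsub i hi))).symm
    _ ≤ _ := by
        refine measure_mono (Set.iUnion₂_subset fun i _ => ?_)
        rintro _ ⟨t, -, rfl⟩
        exact ellipseCurve_mem_frontier c e ha hb t

/-- The chord polygon's length is a Riemann sum of the speed. Averaging over the starting angle φ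
turns it into the exact length integral, leaving only a sinc factor and no error term. -/
theorem sinc_mul_ellipseLength_le (c : Plane) (e : OrthonormalBasis (Fin 2) ℝ Plane)
    {a b : ℝ} (ha : 0 < a) (hb : 0 < b)
    (hfin : Measure.hausdorffMeasure 1 (frontier (ellipse c e a b)) ≠ ⊤) (n : ℕ) :
    Real.sinc (Real.pi * (1 / ((n : ℝ) + 1))) * ellipseLength a b ≤ perimeter (ellipse c e a b) := by
  have hpi := Real.pi_pos
  set L := perimeter (ellipse c e a b) with hL
  -- Half the parameter step of a polygon with n + 1 chords.
  set x : ℝ := Real.pi * (1 / ((n : ℝ) + 1)) with hx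
  have hx0 : 0 < x := by positivity
  have hxpi : x ≤ Real.pi := by
    rw [hx]
    have : 1 / ((n : ℝ) + 1) ≤ 1 := by rw [div_le_one (by positivity)]; linarith [n.cast_nonneg (α := ℝ)]
    nlinarith
  have hsin : 0 ≤ Real.sin x := Real.sin_nonneg_of_nonneg_of_le_pi hx0.le hxpi
  have hN : ((n + 1 : ℕ) : ℝ) * (2 * x) = 2 * Real.pi := by
    rw [hx]; push_cast; field_simp
  set g : ℝ → ℝ := fun t => √((a * Real.sin t) ^ 2 + (b * Real.cos t) ^ 2) with hg
  have hgc : Continuous g := by fun_prop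
  have hsum : ∀ φ : ℝ, 2 * Real.sin x * ∑ i ∈ Finset.range (n + 1), g (φ + (x + i * (2 * x))) ≤ L := by
    intro φ
    have h1 := sum_chords_le_hausdorffMeasure c e ha hb φ (h := 2 * x) (by positivity) hN
    rw [← ENNReal.ofReal_sum_of_nonneg fun _ _ => norm_nonneg _,
      ENNReal.ofReal_le_iff_le_toReal hfin] at h1
    refine le_trans (le_of_eq ?_) h1
    rw [Finset.mul_sum]
    refine Finset.sum_congr rfl fun i _ => ?_
    rw [norm_ellipseCurve_sub]
    have h2 : (φ + (i + 1 : ℕ) * (2 * x) - (φ + i * (2 * x))) / 2 = x := by push_cast; ring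
    have h3 : (φ + (i + 1 : ℕ) * (2 * x) + (φ + i * (2 * x))) / 2 = φ + (x + i * (2 * x)) := by
      push_cast; ring
    rw [h2, h3, abs_of_nonneg hsin]
  have hper : Function.Periodic g (2 * Real.pi) := fun t => by
    simp [hg, Real.cos_add_two_pi, Real.sin_add_two_pi]
  -- The n + 1 shifted intervals of length 2x tile one full period.
  have hint : ∫ φ in (0 : ℝ)..2 * x, ∑ i ∈ Finset.range (n + 1), g (φ + (x + i * (2 * x))) =
      ellipseLength a b := by
    rw [intervalIntegral.integral_finsetSum fun i _ =>
      Continuous.intervalIntegrable (by fun_prop) _ _]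
    have h1 : ∀ i : ℕ, ∫ φ in (0 : ℝ)..2 * x, g (φ + (x + i * (2 * x))) =
        ∫ t in (x + (i : ℕ) * (2 * x))..(x + (i + 1 : ℕ) * (2 * x)), g t := by
      intro i
      rw [intervalIntegral.integral_comp_add_right g]
      congr 1
      · ring
      · push_cast; ring
    simp_rw [h1]
    rw [intervalIntegral.sum_integral_adjacent_intervals (a := fun i : ℕ => x + (i : ℕ) * (2 * x))
      fun i _ => hgc.intervalIntegrable _ _]
    rw [hN]
    have := hper.intervalIntegral_add_eq x 0
    rw [zero_add] at this
    rw [Nat.cast_zero, zero_mul, add_zero, this]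
    rfl
  have hmono : ∫ φ in (0 : ℝ)..2 * x, 2 * Real.sin x *
      ∑ i ∈ Finset.range (n + 1), g (φ + (x + i * (2 * x))) ≤ ∫ _ in (0 : ℝ)..2 * x, L :=
    intervalIntegral.integral_mono_on (by positivity)
      (Continuous.intervalIntegrable (by fun_prop) _ _) (by simp) fun φ _ => hsum φ
  rw [intervalIntegral.integral_const_mul, hint, intervalIntegral.integral_const, smul_eq_mul,
    sub_zero] at hmono
  rw [Real.sinc_of_ne_zero hx0.ne', div_mul_eq_mul_div, div_le_iff₀ hx0]
  nlinarith

theorem ellipseLength_le_perimeter (c : Plane) (e : OrthonormalBasis (Fin 2) ℝ Plane)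
    {a b : ℝ} (ha : 0 < a) (hb : 0 < b)
    (hfin : Measure.hausdorffMeasure 1 (frontier (ellipse c e a b)) ≠ ⊤) :
    ellipseLength a b ≤ perimeter (ellipse c e a b) := by
  have h1 : Filter.Tendsto (fun n : ℕ => Real.pi * (1 / ((n : ℝ) + 1))) Filter.atTop (nhds 0) := by
    simpa using (tendsto_one_div_add_atTop_nhds_zero_nat (𝕜 := ℝ)).const_mul Real.pi
  have h2 := (Real.continuous_sinc.tendsto 0).comp h1
  rw [Real.sinc_zero] at h2
  have h3 := h2.mul_const (ellipseLength a b)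
  rw [one_mul] at h3
  exact le_of_tendsto' h3 (sinc_mul_ellipseLength_le c e ha hb hfin)

theorem ball_eq_ellipse (p : Plane) {r : ℝ} (hr : 0 < r) (e : OrthonormalBasis (Fin 2) ℝ Plane) :
    Metric.ball p r = ellipse p e r r := by
  ext x
  have h := norm_basis_combination_sq e (inner ℝ (e 0) (x - p)) (inner ℝ (e 1) (x - p))
  rw [sum_inner_basis] at h
  rw [mem_ball_iff_norm, mem_ellipse, ← add_div, div_lt_one (by positivity), ← h,
    sq_lt_sq₀ (norm_nonneg _) hr.le]

/-- The parametrisation is Lipschitz with constant max a b over a parameter interval of length 2π.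
For a circle this yields 2πr; for other ellipses only finiteness matters. -/
theorem hausdorffMeasure_frontier_ellipse_le (c : Plane) (e : OrthonormalBasis (Fin 2) ℝ Plane)
    {a b : ℝ} (ha : 0 < a) (hb : 0 < b) :
    Measure.hausdorffMeasure 1 (frontier (ellipse c e a b)) ≤
      ENNReal.ofReal (2 * Real.pi * max a b) := by
  set γ := ellipseCurve c e a b with hγ
  have hm : 0 ≤ max a b := ha.le.trans (le_max_left a b)
  have hlip : LipschitzWith ⟨max a b, hm⟩ γ := by
    refine LipschitzWith.of_dist_le_mul fun t s => ?_
    rw [dist_eq_norm, hγ, norm_ellipseCurve_sub, Real.dist_eq]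
    have h1 : √((a * Real.sin ((t + s) / 2)) ^ 2 + (b * Real.cos ((t + s) / 2)) ^ 2) ≤
        max a b := by
      refine Real.sqrt_le_iff.2 ⟨hm, ?_⟩
      rw [mul_pow, mul_pow]
      calc a ^ 2 * Real.sin ((t + s) / 2) ^ 2 + b ^ 2 * Real.cos ((t + s) / 2) ^ 2
          ≤ max a b ^ 2 * Real.sin ((t + s) / 2) ^ 2 +
            max a b ^ 2 * Real.cos ((t + s) / 2) ^ 2 := by
            gcongr
            exacts [le_max_left a b, le_max_right a b]
        _ = max a b ^ 2 := by rw [← mul_add, Real.sin_sq_add_cos_sq, mul_one]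
    have h2 : |Real.sin ((t - s) / 2)| ≤ |(t - s) / 2| := Real.abs_sin_le_abs
    rw [abs_div, abs_two] at h2
    have h3 : 2 * |Real.sin ((t - s) / 2)| ≤ |t - s| := by linarith
    rw [mul_comm]
    exact mul_le_mul h1 h3 (by positivity) hm
  have hsub : frontier (ellipse c e a b) ⊆ γ '' Set.Icc 0 (2 * Real.pi) := by
    intro x hx
    have hq : (inner ℝ (e 0) (x - c)) ^ 2 / a ^ 2 + (inner ℝ (e 1) (x - c)) ^ 2 / b ^ 2 = 1 :=
      frontier_lt_subset_eq (f := fun x : Plane => (inner ℝ (e 0) (x - c)) ^ 2 / a ^ 2 +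
        (inner ℝ (e 1) (x - c)) ^ 2 / b ^ 2) (by fun_prop) continuous_const hx
    obtain ⟨φ, h0, h1⟩ := exists_polar !₂[inner ℝ (e 0) (x - c) / a, inner ℝ (e 1) (x - c) / b]
    have hnorm : ‖!₂[inner ℝ (e 0) (x - c) / a, inner ℝ (e 1) (x - c) / b]‖ = 1 := by
      rw [EuclideanSpace.norm_eq, Fin.sum_univ_two, Real.sqrt_eq_one, Real.norm_eq_abs,
        Real.norm_eq_abs, sq_abs, sq_abs, ← hq, ← div_pow, ← div_pow]
      rfl
    have hper : Function.Periodic (fun t => (Real.cos t, Real.sin t)) (2 * Real.pi) :=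
      fun t => by simp
    obtain ⟨ψ, hψ, hψφ⟩ := hper.exists_mem_Ico₀ Real.two_pi_pos φ
    obtain ⟨hc, hs⟩ := Prod.ext_iff.1 hψφ
    rw [hnorm, one_mul] at h0 h1
    have h2 : inner ℝ (e 0) (x - c) = a * Real.cos ψ :=
      ((div_eq_iff ha.ne').1 (h0.trans hc)).trans (mul_comm _ _)
    have h3 : inner ℝ (e 1) (x - c) = b * Real.sin ψ :=
      ((div_eq_iff hb.ne').1 (h1.trans hs)).trans (mul_comm _ _)
    refine ⟨ψ, Set.Ico_subset_Icc_self hψ, ?_⟩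
    rw [hγ, ellipseCurve, ← h2, ← h3, sum_inner_basis, add_sub_cancel]
  refine (measure_mono hsub).trans ((hlip.hausdorffMeasure_image_le zero_le_one _).trans ?_)
  rw [hausdorffMeasure_real, Real.volume_Icc, sub_zero, ENNReal.rpow_one, mul_comm (2 * Real.pi),
    ENNReal.ofReal_mul hm]
  refine mul_le_mul_left (le_of_eq ?_) _
  exact (ENNReal.ofReal_eq_coe_nnreal hm).symm

end Perimeter

/-! ### Assembly of the isoperimetric inequality. -/

theorem mainTheorem12 (α : ℝ) (hα0 : 0 < α) (hα1 : α ≤ 1) :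
    (∀ E : Set Plane, IsEllipse E → ∀ k : ℕ, 1 ≤ k →
      IsLeast (eigenvalueLevels α E k) (fracEigenvalue α E k)) ∧
    ∀ n : ℕ, 1 ≤ n → ∀ E D : Set Plane, IsEllipse E → IsDisk D →
      isoperimetricSpectralQuantity α n E ≤ isoperimetricSpectralQuantity α n D := by
  constructor
  · intro E hE k hk
    obtain ⟨c, e, a, b, ha, hb, rfl⟩ := isEllipse_iff.1 hE
    exact isLeast_fracEigenvalue hα0 hα1 (isOpen_ellipse c e a b) (isBounded_ellipse c e ha hb)
      ⟨c, center_mem_ellipse c e a b⟩ hk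
  · intro n _ E D hE hD
    obtain ⟨c, e, a, b, ha, hb, rfl⟩ := isEllipse_iff.1 hE
    obtain ⟨p, r, hr, rfl⟩ := hD
    obtain ⟨hSE, hSD, hle⟩ := sum_fracEigenvalue_ellipse_le hα0 hα1 c p e ha hb hr n
    have hpi := Real.pi_pos
    have hsphere := hausdorffMeasure_frontier_ellipse_le p e hr hr
    rw [← ball_eq_ellipse p hr e, max_self] at hsphere
    have hLDle : perimeter (Metric.ball p r) ≤ 2 * Real.pi * r :=
      ENNReal.toReal_le_of_le_ofReal (by positivity) hsphere
    have hLDpos : 0 < perimeter (Metric.ball p r) := by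
      rw [ball_eq_ellipse p hr e] at hsphere ⊢
      exact (ellipseLength_pos hr hr).trans_le
        (ellipseLength_le_perimeter p e hr hr (ne_top_of_le_ne_top ENNReal.ofReal_ne_top hsphere))
    unfold isoperimetricSpectralQuantity
    rw [area_ellipse c e ha hb, area_ball p hr]
    set SE := ∑ k ∈ Finset.Icc 1 n, fracEigenvalue α (ellipse c e a b) k
    set SD := ∑ k ∈ Finset.Icc 1 n, fracEigenvalue α (Metric.ball p r) k
    set LD := perimeter (Metric.ball p r)
    set LE := perimeter (ellipse c e a b)
    set M := ellipseLength a b with hM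
    have hMpos : 0 < M := ellipseLength_pos ha hb
    have hSD' : 0 ≤ SD ^ (2 / α) := Real.rpow_nonneg hSD _
    -- Since LD ≤ 2πr, the geometric factor π²r⁴/LD² of the disk is at least r²/4. This is the
    -- intermediate value through which both sides are compared.
    have hdisk : SD ^ (2 / α) * (r ^ 2 / 4) ≤
        SD ^ (2 / α) * (Real.pi * r ^ 2) * (Real.pi * r ^ 2 / LD ^ 2) := by
      rw [mul_assoc]
      refine mul_le_mul_of_nonneg_left ?_ hSD'
      have h1 : LD ^ 2 ≤ (2 * Real.pi * r) ^ 2 := by gcongr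
      rw [mul_div_assoc', le_div_iff₀ (by positivity)]
      nlinarith [sq_nonneg r]
    refine le_trans ?_ hdisk
    have hpow : SE ^ (2 / α) ≤ (r * M / (2 * Real.pi * (a * b))) ^ 2 * SD ^ (2 / α) := by
      have h1 := Real.rpow_le_rpow hSE hle (by positivity : 0 ≤ 2 / α)
      have hm : 0 ≤ r * M / (2 * Real.pi * (a * b)) := by positivity
      rw [Real.mul_rpow (by positivity) hSD, ← Real.rpow_mul hm, mul_div_cancel₀ _ hα0.ne'] at h1
      exact_mod_cast h1
    have hfin : Measure.hausdorffMeasure 1 (frontier (ellipse c e a b)) ≠ ⊤ :=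
      ne_top_of_le_ne_top ENNReal.ofReal_ne_top (hausdorffMeasure_frontier_ellipse_le c e ha hb)
    have hMLE : M ≤ LE := ellipseLength_le_perimeter c e ha hb hfin
    have hLEpos : 0 < LE := hMpos.trans_le hMLE
    -- The semiaxes cancel against the area factors, leaving M²/LE², which is at most 1.
    calc SE ^ (2 / α) * (Real.pi * (a * b)) * (Real.pi * (a * b) / LE ^ 2)
        ≤ (r * M / (2 * Real.pi * (a * b))) ^ 2 * SD ^ (2 / α) * (Real.pi * (a * b)) *
          (Real.pi * (a * b) / LE ^ 2) := by gcongr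
      _ = SD ^ (2 / α) * (r ^ 2 / 4) * (M ^ 2 / LE ^ 2) := by field_simp; ring
      _ ≤ SD ^ (2 / α) * (r ^ 2 / 4) * 1 := by
          gcongr
          rw [div_le_one (by positivity)]
          gcongr
      _ = SD ^ (2 / α) * (r ^ 2 / 4) := mul_one _
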